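/- Let $G$ be a plane $1$-periodic graph: a graph (loops and multiple edges allowed, no isolated vertices, edges labeled by signs $\sigma_e=\pm1$) embedded in a strip $I\times\mathbb R$, invariant under the free action of $\mathbb Z=\langle x\rangle$ by unit translations of the second coordinate, which preserve the signs, with finite quotient $\overline G$ in the annulus. Choose representatives $v_{1,0},\dots,v_{N,0}$ of the vertex orbits and put $v_{i,n}=x^n v_{i,0}$. The Laplacian polynomial of $G$ is $\Delta_G=\det(\delta-A)\in\mathbb Z[x^{\pm1}]$, where $A_{ij}$ is the sum of the monomials $\sigma_e x^n$ over all edges $e$ joining $v_{i,0}$ to $v_{j,n}$ (a loop of $\overline G$ contributes two inverse monomials to a diagonal entry) and $\delta$ is the diagonal matrix of signed degrees (loops counted twice). Let $D\subset I\times\mathbb R$ be the (infinite) link diagram obtained from $G$ by the medial construction: every edge of $G$ is replaced by two parallel strands that cross once at the middle of the edge, the sign of the edge deciding which one is the overcrossing, and these strands are joined around the vertices without further crossings. Assume that $D$ is transverse to the lines $I\times\{m\}$, $m\in\mathbb Z$, and that these miss the crossings. Let $D_0=D\cap R$ be the tangle diagram in the fundamental domain $R=I\times[0,1]$; its top (bottom)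 arcs are the arcs meeting $I\times\{1\}$ (respectively $I\times\{0\}$). A $\mathbb T$-coloring of $D$ or $D_0$ assigns to each arc an element of $\mathbb T=\mathbb R/\mathbb Z$ such that at every crossing twice the color of the overcrossing arc is the sum of the colors of the two undercrossing arcs. (1) If the coefficients of $\Delta_G$ are coprime (their greatest common divisor is $1$), then any two distinct $\mathbb T$-colorings of $D_0$ with the same color assignments of the top arcs have different color assignments of the bottom arcs. (2) Suppose that $\Delta_G$ is monic (leading coefficient $\pm1$). If two $\mathbb T$-colorings of $D_0$ that are restrictions of $\mathbb T$-colorings of $D$ agree on the top arcs, then they agree on the bottom arcs. If, moreover, only finitely many $\mathbb T$-colorings of $D_0$ assign $0$ to all top arcs, then any two $\mathbb T$-colorings of $D_0$ (extending to $D$ or not) that agree on the top arcs agree on the bottom arcs. -/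

import Mathlib

open scoped LaurentPolynomial

/-! ### Periodic graphs -/

/-- A finite signed graph `Ḡ` (loops and multiple edges allowed, no isolated vertices) with a
rotation system and a `ℤ`-valued voltage; equivalently, the `1`-periodic graph `G` covering it, with
a cyclic order of the edge ends at each vertex.

The edges of `Ḡ` are `E`; each edge `e` has two ends (darts) `(e, false)`, `(e, true)`, attached to
the vertices `vert (e, false)`, `vert (e, true)`.  The periodic graph `G` has vertices
`(v, k) ∈ V × ℤ` and edges `(e, k) ∈ E × ℤ`, where `(e, k)` joins `(vert (e, false), k)` to
`(vert (e, true), k + volt e)`; the group `ℤ` acts by translating the second coordinate.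
`rot d` is the dart following `d` counterclockwise around its vertex, so that the vertices are
exactly the cycles of `rot`. -/
structure PeriodicGraph (V E : Type*) where
  vert : E × Bool → V
  rot : Equiv.Perm (E × Bool)
  sign : E → ℤˣ
  volt : E → ℤ
  vert_surjective : Function.Surjective vert
  vert_eq_iff : ∀ d d', vert d = vert d' ↔ rot.SameCycle d d'

namespace PeriodicGraph

variable {V E : Type*} (G : PeriodicGraph V E)

/-- The opposite end of the same edge. -/
def rev : Equiv.Perm (E × Bool) := Equiv.prodCongr (Equiv.refl E) Equiv.boolNot

/-- The voltage of an edge of `Ḡ` traversed from the end `d` to the opposite end: the number of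
levels it climbs in `G`. -/
def dartVolt (d : E × Bool) : ℤ := if d.2 then -G.volt d.1 else G.volt d.1

/-- The level of the vertex of `G` at which the lift with index `0` of the edge `d.1` has its end
`d`. -/
def endLevel (d : E × Bool) : ℤ := if d.2 then G.volt d.1 else 0

/-! ### The Laplacian polynomial -/

open Classical in
/-- The adjacency matrix over `ℤ[x, x⁻¹]`: an edge from `v_{i,0}` to `v_{j,n}` contributes `σ xⁿ` to
the entry `(i, j)`; a loop contributes two inverse monomials. -/
noncomputable def adjacency [Fintype E] : Matrix V V ℤ[T;T⁻¹] := fun i j =>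
  ∑ d : E × Bool, if G.vert d = i ∧ G.vert (rev d) = j then
    LaurentPolynomial.C (G.sign d.1 : ℤ) * LaurentPolynomial.T (G.dartVolt d) else 0

open Classical in
/-- The signed degree of a vertex (loops count twice). -/
noncomputable def signedDegree [Fintype E] (i : V) : ℤ :=
  ∑ d : E × Bool, if G.vert d = i then (G.sign d.1 : ℤ) else 0

open Classical in
/-- The Laplacian matrix `L_G = δ - A`. -/
noncomputable def laplacian [Fintype E] : Matrix V V ℤ[T;T⁻¹] :=
  Matrix.diagonal (fun i => LaurentPolynomial.C (G.signedDegree i)) - G.adjacency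

open Classical in
/-- The Laplacian polynomial `Δ_G = det L_G`. -/
noncomputable def laplacianPoly [Fintype V] [Fintype E] : ℤ[T;T⁻¹] := G.laplacian.det

/-! ### Plane periodic graphs -/

/-- The permutation of the darts that walks along the boundary of the face on the left of a dart. -/
def facePerm : Equiv.Perm (E × Bool) := rev.trans G.rot.symm

/-- The faces of the rotation system. -/
def Face : Type _ := Quotient (Equiv.Perm.SameCycle.setoid G.facePerm)

/-- The face on the left of a dart. -/
def face (d : E × Bool) : G.Face := Quotient.mk (Equiv.Perm.SameCycle.setoid G.facePerm) d

/-- The connected components of `Ḡ`. -/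
def Component : Type _ := Quot fun v w : V => ∃ e, G.vert (e, false) = v ∧ G.vert (e, true) = w

/-- The component containing a vertex. -/
def component (v : V) : G.Component := Quot.mk _ v

open Classical in
/-- The total voltage of the boundary walk of the face on the left of `d`. -/
noncomputable def faceVolt [Fintype E] (d : E × Bool) : ℤ :=
  ∑ d' : E × Bool, if G.face d' = G.face d then G.dartVolt d' else 0

/-- `G` is a plane `1`-periodic graph: `Ḡ` is embedded in the annulus so that the given rotation
system is the one induced by the embedding and `G → Ḡ` is the restriction of the universal covering
of the annulus by the strip.  Each component of `Ḡ` is embedded in the sphere (Euler's formula), and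
among its faces at most one contains one of the two ends of the annulus without the other, for
either end: the boundary of such a face winds once around the annulus (`+1` for one end, `-1` for
the other one), and the boundary of every other face has winding number `0`.
How the components are nested in each other has no influence on `Δ_G` or on the crossings and arcs
of the link diagram, and any finite family of such components can be placed disjointly in the
annulus; so the nesting is not recorded. -/
structure IsPlane [Fintype E] : Prop where
  euler : ∀ K : G.Component,
    Nat.card {v : V // G.component v = K}
      + Nat.card {F : G.Face // ∃ d, G.face d = F ∧ G.component (G.vert d) = K}
      = Nat.card {e : E // G.component (G.vert (e, false)) = K} + 2
  abs_faceVolt_le : ∀ d, |G.faceVolt d| ≤ 1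
  face_eq : ∀ d d', G.component (G.vert d) = G.component (G.vert d') →
    G.faceVolt d = G.faceVolt d' → G.faceVolt d ≠ 0 → G.face d = G.face d'

end PeriodicGraph

/-! ### Link and tangle diagrams and their colorings -/

/-- The combinatorial part of a link or tangle diagram.  The curves of the diagram are cut into
`Strand`s at the crossings (and possibly at further places where the diagram ends); at a crossing
`x`, the strands `over₁ x`, `over₂ x` are joined to form the overcrossing, and `under₁ x`, `under₂ x`
are the two strands that stop below it. -/
structure CrossingDiagram (S X : Type*) where
  over₁ : X → S
  over₂ : X → S
  under₁ : X → S
  under₂ : X → S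

namespace CrossingDiagram

variable {S X : Type*} (D : CrossingDiagram S X)

/-- The arcs of a diagram: maximal connected unions of strands, where strands are connected through
overcrossings. -/
def Arc : Type _ := Quot fun s t : S => ∃ x, D.over₁ x = s ∧ D.over₂ x = t

/-- The arc containing a strand. -/
def arc (s : S) : D.Arc := Quot.mk _ s

/-- A `𝕋`-coloring, `𝕋 = ℝ/ℤ`: an assignment of colors to the arcs such that at each crossing twice
the color of the overcrossing arc is the sum of the colors of the undercrossing arcs. -/
def Coloring : Type _ :=
  {c : D.Arc → UnitAddCircle //
    ∀ x, 2 • c (D.arc (D.over₁ x)) = c (D.arc (D.under₁ x)) + c (D.arc (D.under₂ x))}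

end CrossingDiagram

namespace PeriodicGraph

variable {V E : Type*} (G : PeriodicGraph V E)

/-- The diagram `D` of the infinite link associated with `G` by the medial construction.  There is
one crossing on each edge `(e, j)` of `G`.  There is one strand in each corner of `G`: the strand
`(d, k)` runs, near the vertex at level `k` to which `d` is attached, counterclockwise from the edge
of `d` to the edge of `rot d`.  At a crossing the strands that start there are opposite to each
other, and so are the strands that end there.  The former pass over the latter if the sign of the
edge is `+1`, and under them if it is `-1`. -/
def medial : CrossingDiagram ((E × Bool) × ℤ) (E × ℤ) :=
  let starts : E × ℤ → Bool → (E × Bool) × ℤ :=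
    fun x b => ((x.1, b), x.2 + G.endLevel (x.1, b))
  let ends : E × ℤ → Bool → (E × Bool) × ℤ :=
    fun x b => (G.rot.symm (x.1, b), x.2 + G.endLevel (x.1, b))
  { over₁ := fun x => if G.sign x.1 = 1 then starts x false else ends x false
    over₂ := fun x => if G.sign x.1 = 1 then starts x true else ends x true
    under₁ := fun x => if G.sign x.1 = 1 then ends x false else starts x false
    under₂ := fun x => if G.sign x.1 = 1 then ends x true else starts x true }

/-- The position of the diagram `D` in the strip `I × ℝ` relative to the lines `I × {m}`, `m ∈ ℤ`,
which cut the strip into the translates `I × [m, m + 1]` of the fundamental domain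
`R = I × [0, 1]`.  The lines miss the crossings and cross the strands transversely.

`height e` is the `m` for which the crossing on the edge `(e, 0)` of `G` lies in `I × [m, m + 1]`.
The strand of `D` in the corner `(d, k)` meets the lines in `count d` points, and at the `i`-th one
it crosses the line upwards if `dir d i = 1` and downwards if `dir d i = -1`.  All of this is
invariant under translation. -/
structure Position where
  height : E → ℤ
  count : E × Bool → ℕ
  dir : ∀ d, Fin (count d) → ℤˣ
  sum_dir : ∀ d, ∑ i, (dir d i : ℤ)
    = (height (G.rot d).1 - G.endLevel (G.rot d)) - (height d.1 - G.endLevel d)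

namespace Position

variable {G} (P : G.Position)

/-- The pieces into which the lines cut the strands: `(d, p)` is the `p`-th piece of a strand in the
corner `d`, up to translation.  Each piece has exactly one translate in `R`, so these are the strands
of the tangle diagram `D_0 = D ∩ R`. -/
abbrev Piece : Type _ := Σ d : E × Bool, Fin (P.count d + 1)

/-- The points, up to translation, at which the strands meet the lines.  Each has exactly one
translate on the top `I × {1}` of `R` and one on the bottom `I × {0}`. -/
abbrev CutPoint : Type _ := Σ d : E × Bool, Fin (P.count d)

/-- The `m` for which the `p`-th piece of the strand in the corner `(d, 0)` lies in
`I × [m, m + 1]`. -/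
def level (p : P.Piece) : ℤ :=
  (P.height p.1.1 - G.endLevel p.1)
    + ∑ i : Fin (P.count p.1), if i.castSucc < p.2 then (P.dir p.1 i : ℤ) else 0

/-- The tangle diagram `D_0 = D ∩ R`. -/
def tangle : CrossingDiagram P.Piece E :=
  let starts : E → Bool → P.Piece := fun e b => ⟨(e, b), 0⟩
  let ends : E → Bool → P.Piece := fun e b => ⟨G.rot.symm (e, b), Fin.last _⟩
  { over₁ := fun e => if G.sign e = 1 then starts e false else ends e false
    over₂ := fun e => if G.sign e = 1 then starts e true else ends e true
    under₁ := fun e => if G.sign e = 1 then ends e false else starts e false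
    under₂ := fun e => if G.sign e = 1 then ends e true else starts e true }

/-- The arc `a_i` of `D_0` that meets the top of `R` at the point `i`: the piece below the point. -/
def topArc (i : P.CutPoint) : P.tangle.Arc :=
  P.tangle.arc (if P.dir i.1 i.2 = 1 then ⟨i.1, i.2.castSucc⟩ else ⟨i.1, i.2.succ⟩)

/-- The arc `a'_i` of `D_0` that meets the bottom of `R` at the point `i`: the piece above the
point. -/
def bottomArc (i : P.CutPoint) : P.tangle.Arc :=
  P.tangle.arc (if P.dir i.1 i.2 = 1 then ⟨i.1, i.2.succ⟩ else ⟨i.1, i.2.castSucc⟩)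

/-- The strand of `D` that contains the translate in `R` of a piece. -/
def strandOf (p : P.Piece) : (E × Bool) × ℤ := (p.1, -P.level p)

theorem strandOf_start (e : E) (b : Bool) :
    P.strandOf ⟨(e, b), 0⟩ = ((e, b), -P.height e + G.endLevel (e, b)) := by
  simp [strandOf, level]
  ring

theorem strandOf_end (d : E × Bool) :
    P.strandOf ⟨G.rot.symm d, Fin.last _⟩
      = (G.rot.symm d, -P.height d.1 + G.endLevel d) := by
  have h := P.sum_dir (G.rot.symm d)
  simp only [Equiv.apply_symm_apply] at h
  simp only [strandOf, level, Fin.castSucc_lt_last, if_true, h]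
  congr 1
  ring

theorem strandOf_tangle (e : E) :
    P.strandOf (P.tangle.over₁ e) = G.medial.over₁ (e, -P.height e) ∧
    P.strandOf (P.tangle.over₂ e) = G.medial.over₂ (e, -P.height e) ∧
    P.strandOf (P.tangle.under₁ e) = G.medial.under₁ (e, -P.height e) ∧
    P.strandOf (P.tangle.under₂ e) = G.medial.under₂ (e, -P.height e) := by
  by_cases h : G.sign e = 1 <;>
    simp [tangle, medial, h, strandOf_start, strandOf_end]

/-- The arc of `D` that contains a given arc of `D_0`. -/
def arcMap : P.tangle.Arc → G.medial.Arc :=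
  Quot.map P.strandOf fun s t ⟨e, hs, ht⟩ =>
    ⟨(e, -P.height e), by rw [← hs, (P.strandOf_tangle e).1],
      by rw [← ht, (P.strandOf_tangle e).2.1]⟩

theorem arcMap_arc (p : P.Piece) : P.arcMap (P.tangle.arc p) = G.medial.arc (P.strandOf p) := rfl

/-- The restriction to `D_0` of a `𝕋`-coloring of `D`. -/
def restrict (c : G.medial.Coloring) : P.tangle.Coloring :=
  ⟨fun a => c.1 (P.arcMap a), fun e => by
    obtain ⟨h1, -, h3, h4⟩ := P.strandOf_tangle e
    simp only [arcMap_arc, h1, h3, h4]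
    exact c.2 (e, -P.height e)⟩

end Position

end PeriodicGraph

/-- The coefficients are coprime: only units divide all of them. -/
def CoprimeCoeffs (f : ℤ[T;T⁻¹]) : Prop := ∀ a : ℤ, (∀ n : ℤ, a ∣ f.coeff n) → IsUnit a

/-- Monic, as usual for Laurent polynomials up to sign: the leading coefficient is `1` or `-1`. -/
def MonicUpToSign (f : ℤ[T;T⁻¹]) : Prop := ∃ n : ℤ, IsUnit (f.coeff n) ∧ ∀ m, n < m → f.coeff m = 0

/-! Differences of colorings satisfy the same crossing relations, so it suffices to show that
certain colorings vanish. Such a coloring of `R` is continued over all translates of `R`: by zero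
above and, below, by zero in (1) and by further colorings in (2). This gives a coloring of `D`, that
is, a function `C` on the corners of `G`. At an edge, both pairs of opposite corners sum to twice
the overcrossing color. Hence `C` is closed and splits, component by component, into a function `a`
of the vertex plus a function of the face. The rest of the crossing relation says that the signed
increment of `a` along an edge is the jump of the face function across it. Around a vertex the jumps
cancel, so the Laplacian matrix kills `a`, and by Cramer's rule (`shiftAction_det`) `Δ_G` kills
every sequence `k ↦ a v k`. If `Δ_G` acts injectively on sequences with the decay at hand, then `a =
0`, and `C = 0` follows (`eq_zero_of_eventually`). The splitting (`exists_primitive`) is the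
topological input. A spherical component has at most two winding faces, and the sphere minus two
points has cyclic fundamental group; a spanning tree and a cotree make this combinatorial
(`exists_gauge`). If no face winds, the voltages are a coboundary and `Δ_G = 0`, so that case is
excluded. In (1) the sequences have finite support, where coprime coefficients suffice. In (2) they
vanish above some level, where a unit trailing coefficient suffices; `Δ_G` is symmetric, so monic
provides it. For colorings that need not extend to `D`, the continuation downwards exists because
the coloring equations with prescribed top colors form a square integral system, and a finite kernel
over the circle forces a nonzero determinant. -/

/-! ### Cycles of permutations -/

/-- If an equivalence relation links `d` to `π d` for all elements `d` of a cycle but one, then it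
does so for the remaining one too. -/
theorem Equiv.Perm.rel_apply_of_forall_ne {α : Type*} [Finite α] (π : Equiv.Perm α)
    {r : α → α → Prop} (hr : Equivalence r) (d₀ : α)
    (h : ∀ d, π.SameCycle d₀ d → d ≠ d₀ → r d (π d)) : r d₀ (π d₀) := by
  -- Walk along the cycle from `π d₀`. The left alternative records that the walk has returned to
  -- `d₀`, the one element whose step is not available.
  have key : ∀ i : ℕ, r (π d₀) d₀ ∨ r (π d₀) ((π ^ (i + 1)) d₀) := by
    intro i
    induction i with
    | zero => right; simpa using hr.refl _
    | succ i ih =>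
      rcases ih with ih | ih
      · exact Or.inl ih
      · by_cases hd : (π ^ (i + 1)) d₀ = d₀
        · left; rwa [hd] at ih
        · right
          have := h ((π ^ (i + 1)) d₀) ⟨(i + 1 : ℕ), by rw [zpow_natCast]⟩ hd
          rw [pow_succ' π (i + 1), Equiv.Perm.mul_apply]
          exact hr.trans ih this
  rcases key (orderOf π - 1) with h1 | h1
  · exact hr.symm h1
  · rw [Nat.sub_add_cancel (orderOf_pos π), pow_orderOf_eq_one] at h1
    exact hr.symm h1

/-- An equivalence relation that links `d` to `π d` links all elements of a cycle. -/
theorem Equiv.Perm.SameCycle.rel {α : Type*} [Finite α] {π : Equiv.Perm α}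
    {r : α → α → Prop} (hr : Equivalence r) {d₀ d₁ : α} (hd : π.SameCycle d₀ d₁)
    (h : ∀ d, π.SameCycle d₀ d → r d (π d)) : r d₀ d₁ := by
  obtain ⟨i, hi⟩ := hd.exists_nat_pow_eq
  subst hi
  clear hd
  induction i with
  | zero => simpa using hr.refl _
  | succ i ih =>
    rw [pow_succ' π i, Equiv.Perm.mul_apply]
    exact hr.trans ih (h _ ⟨(i : ℕ), by rw [zpow_natCast]⟩)

/-- The sum over a cycle of a permutation, as a sum over the iterates. -/
theorem Equiv.Perm.sum_sameCycle {α A : Type*} [Fintype α] [AddCommMonoid A] (π : Equiv.Perm α)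
    (w : α → A) (d : α) {p : α → Prop} {_ : DecidablePred p} (hp : ∀ d', p d' ↔ π.SameCycle d' d) :
    (∑ d', if p d' then w d' else 0)
      = ∑ i ∈ Finset.range (Function.minimalPeriod π d), w ((π ^ i) d) := by
  rw [← Finset.sum_filter]
  symm
  have hpos : 0 < Function.minimalPeriod π d :=
    Function.minimalPeriod_pos_of_mem_periodicPts
      (Function.Injective.mem_periodicPts π.injective d)
  refine Finset.sum_bij (fun i _ => (π ^ i) d) ?_ ?_ ?_ (fun _ _ => rfl)
  · intro i _
    simp only [Finset.mem_filter, Finset.mem_univ, true_and, hp]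
    exact Equiv.Perm.SameCycle.symm ⟨(i : ℕ), by rw [zpow_natCast]⟩
  · intro i hi j hj hij
    simp only [Finset.mem_range] at hi hj
    simp only [Equiv.Perm.coe_pow] at hij
    exact Function.iterate_injOn_Iio_minimalPeriod hi hj hij
  · intro d' hd'
    simp only [Finset.mem_filter, Finset.mem_univ, true_and, hp] at hd'
    obtain ⟨i, hi⟩ := hd'.symm.exists_nat_pow_eq
    refine ⟨i % Function.minimalPeriod π d, Finset.mem_range.2 (Nat.mod_lt _ hpos), ?_⟩
    rw [← hi, Equiv.Perm.coe_pow, Equiv.Perm.coe_pow, Function.iterate_mod_minimalPeriod_eq]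

/-- A function whose sum over a cycle vanishes is a difference along this cycle. -/
theorem Equiv.Perm.exists_potential {α A : Type*} [Fintype α] [AddCommGroup A]
    (π : Equiv.Perm α) (w : α → A) (d : α) {p : α → Prop} {_ : DecidablePred p}
    (hp : ∀ d', p d' ↔ π.SameCycle d' d) (h : (∑ d', if p d' then w d' else 0) = 0) :
    ∃ n : α → A, ∀ d', p d' → n (π d') = n d' + w d' := by
  classical
  rw [Equiv.Perm.sum_sameCycle π w d hp] at h
  set N := Function.minimalPeriod π d with hN
  have hpos : 0 < N := Function.minimalPeriod_pos_of_mem_periodicPts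
      (Function.Injective.mem_periodicPts π.injective d)
  have hmod : ∀ i, (π ^ (i % N)) d = (π ^ i) d := fun i => by
    rw [Equiv.Perm.coe_pow, Equiv.Perm.coe_pow, hN, Function.iterate_mod_minimalPeriod_eq]
  have hex : ∀ d', π.SameCycle d' d → ∃ i, i < N ∧ (π ^ i) d = d' := fun d' hd' => by
    obtain ⟨i, hi⟩ := hd'.symm.exists_nat_pow_eq
    exact ⟨i % N, Nat.mod_lt _ hpos, by rw [hmod, hi]⟩
  let s : ℕ → A := fun i => ∑ j ∈ Finset.range i, w ((π ^ j) d)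
  let n : α → A := fun d' => if hd : π.SameCycle d' d then s (hex d' hd).choose else 0
  have hn : ∀ i, i < N → n ((π ^ i) d) = s i := by
    intro i hi
    have hd : π.SameCycle ((π ^ i) d) d :=
      Equiv.Perm.SameCycle.symm ⟨(i : ℕ), by rw [zpow_natCast]⟩
    simp only [n, dif_pos hd]
    obtain ⟨h1, h2⟩ := (hex _ hd).choose_spec
    congr 1
    exact Function.iterate_injOn_Iio_minimalPeriod h1 hi
      (by simpa only [Equiv.Perm.coe_pow] using h2)
  refine ⟨n, fun d' hd' => ?_⟩
  obtain ⟨i, hi, rfl⟩ := hex d' ((hp d').1 hd')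
  rw [hn i hi, ← Equiv.Perm.mul_apply, ← pow_succ']
  have hs : s (i + 1) = s i + w ((π ^ i) d) := Finset.sum_range_succ _ _
  rw [← hs]
  rcases Nat.lt_or_ge (i + 1) N with h1 | h1
  · exact hn _ h1
  · have h2 : i + 1 = N := le_antisymm hi h1
    -- Closing the cycle: the partial sum over a full period is zero, which is also the value at the
    -- start.
    rw [h2, show s N = 0 from h, ← hmod N, Nat.mod_self, hn 0 hpos]
    rfl

/-! ### Rooted spanning trees -/

open PeriodicGraph

@[simp] theorem PeriodicGraph.rev_rev {E : Type*} (d : E × Bool) : rev (rev d) = d := by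
  obtain ⟨e, b⟩ := d; cases b <;> rfl

@[simp] theorem PeriodicGraph.rev_fst {E : Type*} (d : E × Bool) : (rev d).1 = d.1 := rfl

theorem PeriodicGraph.eq_or_eq_rev_of_fst_eq {E : Type*} {d d' : E × Bool} (h : d.1 = d'.1) :
    d = d' ∨ d = rev d' := by
  obtain ⟨e, b⟩ := d; obtain ⟨e', b'⟩ := d'
  obtain rfl : e = e' := h
  cases b <;> cases b' <;> simp [rev]

/-- A spanning tree, with root `root`, of the part `S` of the graph with the incidence function
`node`, all of whose edges satisfy `A`: the edge that leads from `n` towards the root has the end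
`par n` at `n`. -/
structure RootedSpanningTree {E N : Type*} (node : E × Bool → N) (S : Set N) (root : N)
    (A : E → Prop) where
  par : N → E × Bool
  depth : N → ℕ
  allowed : ∀ n ∈ S, n ≠ root → A (par n).1
  node_par : ∀ n ∈ S, n ≠ root → node (par n) = n
  depth_lt : ∀ n ∈ S, n ≠ root → depth (node (rev (par n))) < depth n

namespace RootedSpanningTree

variable {E N : Type*} {node : E × Bool → N} {S : Set N} {root : N} {A : E → Prop}

/-- Adjacency through edges that satisfy `A`. -/
def Adj (node : E × Bool → N) (A : E → Prop) (m n : N) : Prop :=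
  ∃ d, A d.1 ∧ node d = m ∧ node (rev d) = n

theorem Adj.symm {m n : N} : Adj node A m n → Adj node A n m :=
  fun ⟨d, h, h1, h2⟩ => ⟨rev d, h, h2, by rwa [rev_rev]⟩

theorem equivalence_reflTransGen : Equivalence (Relation.ReflTransGen (Adj node A)) where
  refl _ := .refl
  symm h := by
    induction h with
    | refl => exact .refl
    | tail _ h2 ih => exact .head h2.symm ih
  trans := .trans

/-- A connected graph has a rooted spanning tree. -/
theorem nonempty [Nonempty E] (h : ∀ n, n ∈ S ↔ Relation.ReflTransGen (Adj node A) root n) :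
    Nonempty (RootedSpanningTree node S root A) := by
  classical
  let reach : ℕ → N → Prop := fun k => Nat.rec (fun n => n = root)
    (fun _ R n => ∃ m, R m ∧ Adj node A m n) k
  have hreach : ∀ n, n ∈ S ↔ ∃ k, reach k n := by
    intro n
    rw [h]
    constructor
    · intro hn
      induction hn with
      | refl => exact ⟨0, rfl⟩
      | tail _ h2 ih => obtain ⟨k, hk⟩ := ih; exact ⟨k + 1, _, hk, h2⟩
    · rintro ⟨k, hk⟩
      induction k generalizing n with
      | zero => obtain rfl : n = root := hk; exact .refl
      | succ k ih => obtain ⟨m, hm, hmn⟩ := hk; exact (ih m hm).tail hmn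
  let depth : N → ℕ := fun n => sInf {k | reach k n}
  have key : ∀ n, ∃ d, n ∈ S → n ≠ root → A d.1 ∧ node d = n ∧
      depth (node (rev d)) < depth n := by
    intro n
    by_cases hn : n ∈ S ∧ n ≠ root
    swap
    · exact ⟨(Classical.arbitrary E, true), fun h1 h2 => absurd ⟨h1, h2⟩ hn⟩
    obtain ⟨hS, hr⟩ := hn
    have hmem : reach (depth n) n := Nat.sInf_mem ((hreach n).1 hS)
    rcases hk : depth n with _ | k
    · rw [hk] at hmem; exact absurd hmem hr
    · rw [hk] at hmem
      obtain ⟨m, hm, hmn⟩ := hmem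
      obtain ⟨d, h1, h2, h3⟩ := hmn.symm
      refine ⟨d, fun _ _ => ⟨h1, h2, ?_⟩⟩
      rw [h3]; exact Nat.lt_succ_of_le (Nat.sInf_le hm)
  choose par hpar using key
  exact ⟨⟨par, depth, fun n h1 h2 => (hpar n h1 h2).1, fun n h1 h2 => (hpar n h1 h2).2.1,
    fun n h1 h2 => (hpar n h1 h2).2.2⟩⟩

variable (t : RootedSpanningTree node S root A)

/-- The edges of the tree. -/
def IsTreeEdge (e : E) : Prop := ∃ n ∈ S, n ≠ root ∧ (t.par n).1 = e

/-- An edge cannot lead towards the root from both of its ends, because the depth would drop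
strictly in both directions. Tree edges are therefore counted by the nodes other than the root. -/
theorem par_injective {m n : N} (hm : m ∈ S) (hm' : m ≠ root) (hn : n ∈ S) (hn' : n ≠ root)
    (h : (t.par m).1 = (t.par n).1) : m = n := by
  rcases eq_or_eq_rev_of_fst_eq h with h | h
  · rw [← t.node_par m hm hm', h, t.node_par n hn hn']
  · have h1 := t.depth_lt n hn hn'
    have h2 := t.depth_lt m hm hm'
    rw [← h, t.node_par m hm hm'] at h1
    rw [h, rev_rev, t.node_par n hn hn'] at h2
    omega

/-- Induction from the leaves towards the root. -/
theorem prune [Finite N] {P : E → Prop} (hP : ∀ e, ¬ t.IsTreeEdge e → P e)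
    (h : ∀ n ∈ S, n ≠ root → (∀ d, node d = n → d ≠ t.par n → P d.1) → P (t.par n).1) (e : E) :
    P e := by
  by_cases he : t.IsTreeEdge e
  swap
  · exact hP e he
  obtain ⟨n, hn, hn', rfl⟩ := he
  obtain ⟨B, hB⟩ := (Set.finite_range t.depth).bddAbove
  induction hk : B - t.depth n using Nat.strong_induction_on generalizing n with
  | _ k ih =>
  refine h n hn hn' fun d hd hne => ?_
  by_cases he : t.IsTreeEdge d.1
  swap
  · exact hP _ he
  obtain ⟨m, hm, hm', hmd⟩ := he
  rcases eq_or_eq_rev_of_fst_eq hmd with h1 | h1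
  · rw [← h1, t.node_par m hm hm'] at hd
    subst hd
    exact absurd h1.symm hne
  · have h2 := t.depth_lt m hm hm'
    rw [h1, rev_rev, hd] at h2
    have h3 : t.depth m ≤ B := hB ⟨m, rfl⟩
    rw [← hmd]
    exact ih (B - t.depth m) (by omega) m hm hm' rfl

/-- A function on the darts with values in a group is trivial on a tree up to a gauge
transformation. -/
theorem exists_gauge [Finite N] {Γ : Type*} [Group Γ] (g : E × Bool → Γ) :
    ∃ h : N → Γ, ∀ n ∈ S, n ≠ root →
      g (t.par n) = h (node (rev (t.par n))) * (h n)⁻¹ := by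
  classical
  have key : ∀ k, ∃ h : N → Γ, ∀ n ∈ S, n ≠ root → t.depth n < k →
      g (t.par n) = h (node (rev (t.par n))) * (h n)⁻¹ := by
    intro k
    induction k with
    | zero => exact ⟨1, fun _ _ _ h => absurd h (Nat.not_lt_zero _)⟩
    | succ k ih =>
      obtain ⟨h, hh⟩ := ih
      -- The required equation is solved for `h n` at depth `k`; the parent has smaller depth, so
      -- its value is already fixed.
      refine ⟨fun n => if t.depth n = k then (g (t.par n))⁻¹ * h (node (rev (t.par n))) else h n,
        fun n hn hn' hlt => ?_⟩
      have h1 := t.depth_lt n hn hn'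
      dsimp only
      rw [if_neg (by omega : t.depth (node (rev (t.par n))) ≠ k)]
      by_cases hk : t.depth n = k
      · rw [if_pos hk]; group
      · rw [if_neg hk]; exact hh n hn hn' (by omega)
  obtain ⟨B, hB⟩ := (Set.finite_range t.depth).bddAbove
  obtain ⟨h, hh⟩ := key (B + 1)
  exact ⟨h, fun n hn hn' => hh n hn hn' (Nat.lt_succ_of_le (hB ⟨n, rfl⟩))⟩

end RootedSpanningTree

/-! ### Laurent polynomials acting on sequences -/

namespace LaurentPolynomial

variable {M : Type*} [AddCommGroup M]

/-- The translations of sequences. -/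
def shift (M : Type*) [AddCommGroup M] : Multiplicative ℤ →* Module.End ℤ (ℤ → M) where
  toFun n :=
    { toFun := fun a k => a (k + n.toAdd)
      map_add' := fun _ _ => rfl
      map_smul' := fun _ _ => rfl }
  map_one' := by ext a k; simp
  map_mul' m n := by
    ext a k
    simp only [toAdd_mul, LinearMap.coe_mk, AddHom.coe_mk, Module.End.mul_apply]
    congr 1; ring

/-- The action of Laurent polynomials on sequences for which `x ^ n` translates by `n`. -/
noncomputable def shiftAction (M : Type*) [AddCommGroup M] :
    ℤ[T;T⁻¹] →ₐ[ℤ] Module.End ℤ (ℤ → M) :=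
  AddMonoidAlgebra.lift ℤ _ ℤ (shift M)

theorem shiftAction_apply (f : ℤ[T;T⁻¹]) (a : ℤ → M) (k : ℤ) :
    shiftAction M f a k = f.coeff.sum fun n z => z • a (k + n) := by
  rw [shiftAction, AddMonoidAlgebra.lift_apply, Finsupp.sum, Finsupp.sum,
    LinearMap.sum_apply, Finset.sum_apply]
  rfl

theorem shiftAction_C_mul_T (z n : ℤ) (a : ℤ → M) (k : ℤ) :
    shiftAction M (C z * T n) a k = z • a (k + n) := by
  rw [shiftAction_apply, ← single_eq_C_mul_T, AddMonoidAlgebra.coeff_single,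
    Finsupp.sum_single_index (h := fun n z => z • a (k + n)) (zero_smul _ _)]

theorem shiftAction_C (z : ℤ) (a : ℤ → M) (k : ℤ) :
    shiftAction M (C z) a k = z • a k := by
  have := shiftAction_C_mul_T z 0 a k
  rwa [T_zero, mul_one, add_zero] at this

/-- If all coefficients below the `n`-th one kill `a`, and `a` vanishes above `K`, then the
`n`-th coefficient maps the value at `K` to a value of `f • a`. -/
theorem shiftAction_apply_sub (f : ℤ[T;T⁻¹]) (a : ℤ → M) {n K : ℤ}
    (hf : ∀ m < n, ∀ k, f.coeff m • a k = 0) (ha : ∀ k, K < k → a k = 0) :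
    shiftAction M f a (K - n) = f.coeff n • a K := by
  rw [shiftAction_apply, Finsupp.sum, Finset.sum_eq_single n]
  · rw [sub_add_cancel]
  · intro m _ hm
    rcases lt_or_gt_of_ne hm with h | h
    · exact hf m h _
    · rw [ha _ (by omega), smul_zero]
  · intro hn
    rw [Finsupp.notMem_support_iff.1 hn, zero_smul]

/-- A Laurent polynomial with coprime coefficients is not a zero divisor on finitely supported
sequences. -/
theorem eq_zero_of_coprimeCoeffs {f : ℤ[T;T⁻¹]} (hf : CoprimeCoeffs f) {a : ℤ → M}
    {lo hi : ℤ} (hlo : ∀ k < lo, a k = 0) (hhi : ∀ k, hi ≤ k → a k = 0)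
    (h : shiftAction M f a = 0) : a = 0 := by
  induction hw : (hi - lo).toNat generalizing a hi with
  | zero =>
    funext k
    rcases lt_or_ge k lo with h1 | h1
    · exact hlo k h1
    · exact hhi k (by omega)
  | succ w ih =>
    obtain ⟨n₀, hn₀⟩ := f.coeff.support.finite_toSet.bddBelow
    -- The coefficients are shown to kill `a` one by one from below. Once the lower ones do, the top
    -- value of `f.coeff n • a` is a value of `f • a`, hence zero. So `f.coeff n • a` is a shorter
    -- sequence killed by `f`, and the outer induction applies.
    have hkill : ∀ j : ℕ, ∀ n < n₀ + j, f.coeff n • a = 0 := by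
      intro j
      induction j with
      | zero =>
        intro n hn
        have : f.coeff n = 0 := by
          by_contra hne
          have := hn₀ (Finset.mem_coe.2 (Finsupp.mem_support_iff.2 hne))
          simp at hn; omega
        rw [this, zero_smul]
      | succ j ihj =>
        intro n hn
        rcases lt_or_ge n (n₀ + j) with h1 | h1
        · exact ihj n h1
        obtain rfl : n = n₀ + j := by push_cast at hn; omega
        refine ih (hi := hi - 1) (fun k hk => ?_) (fun k hk => ?_) ?_ (by omega)
        · rw [Pi.smul_apply, hlo k hk, smul_zero]
        · rcases eq_or_lt_of_le hk with h2 | h2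
          · rw [Pi.smul_apply, ← h2, ← shiftAction_apply_sub f a
              (fun m hm k => congrFun (ihj m hm) k) (fun k hk => hhi k (by omega)), h]
            rfl
          · rw [Pi.smul_apply, hhi k (by omega), smul_zero]
        · rw [map_smul, h, smul_zero]
    -- The annihilator of `a` in `ℤ` contains all coefficients; its generator divides them all and
    -- is therefore a unit.
    obtain ⟨z, hz⟩ := IsPrincipalIdealRing.principal
      (LinearMap.ker (LinearMap.toSpanSingleton ℤ (ℤ → M) a))
    have hunit : IsUnit z := hf z fun n => by
      have : f.coeff n ∈ LinearMap.ker (LinearMap.toSpanSingleton ℤ (ℤ → M) a) := by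
        rw [LinearMap.mem_ker, LinearMap.toSpanSingleton_apply]
        exact hkill (n - n₀ + 1).toNat n (by omega)
      rw [hz] at this
      exact Ideal.mem_span_singleton.1 this
    have h1 : (1 : ℤ) ∈ LinearMap.ker (LinearMap.toSpanSingleton ℤ (ℤ → M) a) := by
      rw [hz]
      exact Ideal.mem_span_singleton.2 hunit.dvd
    rwa [LinearMap.mem_ker, LinearMap.toSpanSingleton_apply, one_smul] at h1

/-- A Laurent polynomial whose trailing coefficient is a unit is not a zero divisor on sequences
that vanish above some index. -/
theorem eq_zero_of_isUnit_trailing {f : ℤ[T;T⁻¹]} {n : ℤ} (hn : IsUnit (f.coeff n))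
    (hf : ∀ m < n, f.coeff m = 0) {a : ℤ → M} {hi : ℤ} (hhi : ∀ k, hi ≤ k → a k = 0)
    (h : shiftAction M f a = 0) : a = 0 := by
  have key : ∀ j : ℕ, ∀ k, hi - j ≤ k → a k = 0 := by
    intro j
    induction j with
    | zero => simpa using hhi
    | succ j ih =>
      intro k hk
      rcases lt_or_ge k (hi - j) with h1 | h1
      · have h2 := shiftAction_apply_sub f a (n := n) (K := k)
          (fun m hm k => by rw [hf m hm, zero_smul]) (fun k' hk' => ih k' (by push_cast at hk; omega))
        rw [h] at h2
        rcases Int.isUnit_iff.1 hn with h3 | h3 <;> rw [h3] at h2 <;> simpa using h2.symm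
      · exact ih k h1
  funext k
  exact key (hi - k).toNat k (by omega)

/-- Cramer's rule: the determinant kills every solution of a homogeneous system. -/
theorem shiftAction_det {V : Type*} [Fintype V] [DecidableEq V] (L : Matrix V V ℤ[T;T⁻¹])
    (a : V → ℤ → M) (h : ∀ i, ∑ j, shiftAction M (L i j) (a j) = 0) (j : V) :
    shiftAction M L.det (a j) = 0 := by
  have h1 : ∀ l, shiftAction M ((L.adjugate * L) j l) (a l)
      = ∑ i, shiftAction M (L.adjugate j i) (shiftAction M (L i l) (a l)) := fun l => by
    rw [Matrix.mul_apply, map_sum, LinearMap.sum_apply]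
    simp only [map_mul, Module.End.mul_apply]
  have h2 : ∑ l, shiftAction M ((L.adjugate * L) j l) (a l) = 0 := by
    simp only [h1]
    rw [Finset.sum_comm]
    refine Finset.sum_eq_zero fun i _ => ?_
    rw [← map_sum, h i, map_zero]
  rw [Matrix.adjugate_mul, Finset.sum_eq_single j] at h2
  · simpa using h2
  · intro l _ hl
    simp [Matrix.one_apply_ne hl.symm]
  · simp

end LaurentPolynomial

/-! ### The Laplacian -/

namespace PeriodicGraph

open LaurentPolynomial

variable {V E : Type*} (G : PeriodicGraph V E)

@[simp] theorem dartVolt_rev (d : E × Bool) : G.dartVolt (rev d) = - G.dartVolt d := by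
  obtain ⟨e, b⟩ := d; cases b <;> simp [dartVolt, rev]

theorem component_vert_rev (d : E × Bool) :
    G.component (G.vert (rev d)) = G.component (G.vert d) := by
  obtain ⟨e, b⟩ := d
  have h : G.component (G.vert (e, false)) = G.component (G.vert (e, true)) :=
    Quot.sound (r := fun v w : V => ∃ e, G.vert (e, false) = v ∧ G.vert (e, true) = w)
      ⟨e, rfl, rfl⟩
  cases b
  · exact h.symm
  · exact h

variable [Fintype V] [Fintype E]

open Classical in
/-- The action of the Laplacian matrix, as a sum over the darts at a vertex. -/
theorem sum_shiftAction_laplacian {M : Type*} [AddCommGroup M] (a : V → ℤ → M) (i : V) (k : ℤ) :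
    (∑ j, shiftAction M (G.laplacian i j) (a j)) k
      = ∑ d : E × Bool, if G.vert d = i then
          (G.sign d.1 : ℤ) • (a i k - a (G.vert (rev d)) (k + G.dartVolt d)) else 0 := by
  have h1 : ∀ j, shiftAction M (G.adjacency i j) (a j) k
      = ∑ d : E × Bool, if G.vert d = i ∧ G.vert (rev d) = j then
        (G.sign d.1 : ℤ) • a j (k + G.dartVolt d) else 0 := fun j => by
    rw [adjacency, map_sum, LinearMap.sum_apply, Finset.sum_apply]
    refine Finset.sum_congr rfl fun d _ => ?_
    split_ifs with h
    · exact shiftAction_C_mul_T _ _ _ _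
    · simp
  have h2 : ∀ j, shiftAction M (G.laplacian i j) (a j) k
      = (if i = j then G.signedDegree i • a i k else 0)
        - ∑ d : E × Bool, if G.vert d = i ∧ G.vert (rev d) = j then
        (G.sign d.1 : ℤ) • a j (k + G.dartVolt d) else 0 := fun j => by
    rw [laplacian, Matrix.sub_apply, map_sub, LinearMap.sub_apply, Pi.sub_apply, h1,
      Matrix.diagonal_apply]
    congr 1
    split_ifs with h
    · subst h; exact shiftAction_C _ _ _
    · simp
  rw [Finset.sum_apply]
  simp only [h2]
  rw [Finset.sum_sub_distrib, Finset.sum_ite_eq Finset.univ i, if_pos (Finset.mem_univ _),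
    Finset.sum_comm, signedDegree, Finset.sum_smul, ← Finset.sum_sub_distrib]
  refine Finset.sum_congr rfl fun d _ => ?_
  by_cases h : G.vert d = i
  · simp [h, smul_sub]
  · simp [h]

/-- The Laplacian polynomial is symmetric. -/
theorem invert_laplacianPoly : invert G.laplacianPoly = G.laplacianPoly := by
  classical
  have h : G.laplacian.map (invert (R := ℤ)) = G.laplacian.transpose := by
    ext1 i j
    rw [Matrix.map_apply, Matrix.transpose_apply, laplacian, Matrix.sub_apply, Matrix.sub_apply,
      map_sub, Matrix.diagonal_apply, Matrix.diagonal_apply]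
    congr 1
    · split_ifs with h1 h2 h2
      · subst h1; simp
      · exact absurd h1.symm h2
      · exact absurd h2.symm h1
      · simp
    · rw [adjacency, adjacency, map_sum, ← Equiv.sum_comp rev]
      refine Finset.sum_congr rfl fun d _ => ?_
      rw [rev_rev]
      by_cases h : G.vert (rev d) = i ∧ G.vert d = j
      · rw [if_pos h, if_pos h.symm]; simp
      · rw [if_neg h, if_neg fun h' => h h'.symm, map_zero]
  have h2 := AlgEquiv.map_det (invert (R := ℤ)) G.laplacian
  rw [laplacianPoly]
  convert h2.trans ?_
  rw [AlgEquiv.mapMatrix_apply, h, Matrix.det_transpose]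

/-- If the voltages around a component are a coboundary, then the Laplacian polynomial vanishes. -/
theorem laplacianPoly_eq_zero (K : G.Component) (hK : ∃ v, G.component v = K) (n : V → ℤ)
    (h : ∀ d, G.component (G.vert d) = K → G.dartVolt d = n (G.vert (rev d)) - n (G.vert d)) :
    G.laplacianPoly = 0 := by
  classical
  obtain ⟨v, hv⟩ := hK
  -- After the levels are corrected by `n`, this sequence is constant along every edge of the
  -- component, hence harmonic. Acting on it recovers the polynomial itself, so a polynomial that
  -- kills it is zero.
  let a : V → ℤ → ℤ[T;T⁻¹] := fun v k => if G.component v = K then T (k - n v) else 0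
  have hL : ∀ i, ∑ j, shiftAction ℤ[T;T⁻¹] (G.laplacian i j) (a j) = 0 := by
    intro i
    funext k
    rw [sum_shiftAction_laplacian]
    refine Finset.sum_eq_zero fun d _ => ?_
    split_ifs with hd
    · subst hd
      simp only [a, component_vert_rev]
      split_ifs with hc
      · rw [h d hc, show k + (n (G.vert (rev d)) - n (G.vert d)) - n (G.vert (rev d))
          = k - n (G.vert d) by ring, sub_self, smul_zero]
      · simp
    · rfl
  have h1 := shiftAction_det G.laplacian a hL v
  have h2 : ∀ f : ℤ[T;T⁻¹], shiftAction ℤ[T;T⁻¹] f (a v) (n v) = f := fun f => by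
    rw [shiftAction_apply]
    conv_rhs => rw [← AddMonoidAlgebra.sum_coeff_single f]
    refine Finset.sum_congr rfl fun m _ => ?_
    simp only [a, if_pos hv]
    rw [single_eq_C_mul_T, add_sub_cancel_left, smul_eq_C_mul]
  rw [laplacianPoly, ← h2 (Matrix.det _)]
  exact congrFun h1 (n v)

end PeriodicGraph

/-! ### Connectedness of the graph and of the complement of a spanning tree in the dual graph -/

namespace PeriodicGraph

variable {V E : Type*} (G : PeriodicGraph V E)

theorem component_vert_false (d : E × Bool) :
    G.component (G.vert (d.1, false)) = G.component (G.vert d) := by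
  obtain ⟨e, b⟩ := d
  cases b
  · rfl
  · exact G.component_vert_rev (e, true)

variable {G} in
/-- A property of vertices that passes from one end of an edge to the other one holds on a whole
component. -/
theorem component_induction {Q : V → Prop} (h : ∀ d, Q (G.vert d) → Q (G.vert (rev d))) {v w : V}
    (hvw : G.component v = G.component w) (hv : Q v) : Q w := by
  let F : G.Component → Prop := Quot.lift Q fun a b ⟨e, ha, hb⟩ => by
    subst ha hb
    exact propext ⟨h (e, false), h (e, true)⟩
  have h1 : F (G.component v) := hv
  rw [hvw] at h1
  exact h1

theorem vert_rot (d : E × Bool) : G.vert (G.rot d) = G.vert d :=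
  (G.vert_eq_iff _ _).2 (Equiv.Perm.SameCycle.symm ⟨1, by simp⟩)

theorem vert_rot_symm (d : E × Bool) : G.vert (G.rot.symm d) = G.vert d := by
  have := G.vert_rot (G.rot.symm d)
  rw [Equiv.apply_symm_apply] at this
  exact this.symm

theorem facePerm_apply (d : E × Bool) : G.facePerm d = G.rot.symm (rev d) := rfl

theorem vert_facePerm (d : E × Bool) : G.vert (G.facePerm d) = G.vert (rev d) :=
  G.vert_rot_symm _

theorem face_eq_iff {d d' : E × Bool} : G.face d = G.face d' ↔ G.facePerm.SameCycle d d' :=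
  Quotient.eq (r := Equiv.Perm.SameCycle.setoid G.facePerm)

theorem face_facePerm (d : E × Bool) : G.face (G.facePerm d) = G.face d :=
  (G.face_eq_iff).2 (Equiv.Perm.SameCycle.symm ⟨1, by simp⟩)

/-- One clockwise turn around a vertex crosses one edge, from the face on its left to the face on
its right. Turning around a vertex thus becomes a walk in the dual graph. -/
theorem face_rot_symm (d : E × Bool) : G.face (G.rot.symm d) = G.face (rev d) := by
  rw [← G.face_facePerm (rev d), facePerm_apply, rev_rev]

theorem component_vert_facePerm (d : E × Bool) :
    G.component (G.vert (G.facePerm d)) = G.component (G.vert d) := by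
  rw [vert_facePerm, component_vert_rev]

theorem component_eq_of_face_eq [Finite E] {d d' : E × Bool} (h : G.face d = G.face d') :
    G.component (G.vert d) = G.component (G.vert d') :=
  Equiv.Perm.SameCycle.rel (r := fun d d' => G.component (G.vert d) = G.component (G.vert d'))
    ⟨fun _ => rfl, Eq.symm, Eq.trans⟩ (G.face_eq_iff.1 h)
    fun d _ => (G.component_vert_facePerm d).symm

instance [Finite E] : Finite G.Face := inferInstanceAs (Finite (Quotient _))

theorem finite_vertices {V E : Type*} (G : PeriodicGraph V E) [Finite E] : Finite V :=
  Finite.of_surjective _ G.vert_surjective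

/-- A component has a spanning tree. -/
theorem exists_tree [Nonempty E] (v₀ : V) :
    Nonempty (RootedSpanningTree G.vert {v | G.component v = G.component v₀} v₀ fun _ => True) := by
  refine RootedSpanningTree.nonempty fun v => ⟨fun hv => ?_, fun hv => ?_⟩
  · exact component_induction (Q := Relation.ReflTransGen
      (RootedSpanningTree.Adj G.vert fun _ => True) v₀)
      (fun d hd => hd.tail ⟨d, trivial, rfl, rfl⟩) (Eq.symm hv) .refl
  · induction hv with
    | refl => rfl
    | tail _ h ih =>
      obtain ⟨d, -, rfl, rfl⟩ := h
      exact (G.component_vert_rev d).trans ih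

/-- The dual edges of the edges outside a spanning tree have a spanning tree. -/
theorem exists_cotree [Finite E] {d₀ : E × Bool} {S : Set V}
    {v₀ : V} {A : E → Prop} (t : RootedSpanningTree G.vert S v₀ A) :
    Nonempty (RootedSpanningTree G.face
      {F | ∃ d, G.face d = F ∧ G.component (G.vert d) = G.component (G.vert d₀)} (G.face d₀)
      fun e => ¬ t.IsTreeEdge e) := by
  have := G.finite_vertices
  have : Nonempty E := ⟨d₀.1⟩
  set A' : E → Prop := fun e => ¬ t.IsTreeEdge e
  let R := Relation.ReflTransGen (RootedSpanningTree.Adj G.face A')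
  have hR : Equivalence R := RootedSpanningTree.equivalence_reflTransGen
  have hdart : ∀ {d d' : E × Bool}, d.1 = d'.1 → R (G.face d') (G.face (rev d')) →
      R (G.face d) (G.face (rev d)) := by
    intro d d' h h1
    rcases eq_or_eq_rev_of_fst_eq h with rfl | rfl
    · exact h1
    · rw [rev_rev]; exact hR.symm h1
  -- The two sides of a non-tree edge are adjacent in the dual graph. For a tree edge, pruned from
  -- the leaves, go around its outer vertex the other way: all other edges there can already be
  -- crossed.
  have hcross : ∀ e, R (G.face (e, false)) (G.face (rev (e, false))) := by
    refine t.prune (fun e he => .single ⟨(e, false), he, rfl, rfl⟩) fun n hn hn' h => ?_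
    refine hdart (d' := t.par n) rfl ?_
    rw [← face_rot_symm]
    refine Equiv.Perm.rel_apply_of_forall_ne G.rot.symm (r := fun d d' => R (G.face d) (G.face d'))
      ⟨fun _ => hR.refl _, hR.symm, hR.trans⟩ _ fun d hd hne => ?_
    rw [face_rot_symm]
    refine hdart (d' := (d.1, false)) rfl (h d ?_ hne)
    rw [← t.node_par n hn hn', eq_comm, G.vert_eq_iff]
    exact Equiv.Perm.sameCycle_inv.1 hd
  have hcross' : ∀ d, R (G.face d) (G.face (rev d)) := fun d =>
    hdart (d' := (d.1, false)) rfl (hcross _)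
  have hvert : ∀ d d', G.vert d = G.vert d' → R (G.face d) (G.face d') := fun d d' h =>
    Equiv.Perm.SameCycle.rel (r := fun d d' => R (G.face d) (G.face d'))
      ⟨fun _ => hR.refl _, hR.symm, hR.trans⟩ (Equiv.Perm.sameCycle_inv.2 ((G.vert_eq_iff _ _).1 h))
      fun d _ => by
        change R _ (G.face (G.rot.symm d))
        rw [face_rot_symm]; exact hcross' d
  refine RootedSpanningTree.nonempty fun F => ⟨?_, fun hF => ?_⟩
  · rintro ⟨d, rfl, hd⟩
    refine component_induction (Q := fun v => ∀ d, G.vert d = v → R (G.face d₀) (G.face d))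
      (fun d hd d' hd' => ?_) hd.symm (fun d' hd' => hvert _ _ hd'.symm) d rfl
    exact hR.trans (hR.trans (hd d rfl) (hcross' d)) (hvert _ _ hd'.symm)
  · induction hF with
    | refl => exact ⟨d₀, rfl, rfl⟩
    | tail _ h ih =>
      obtain ⟨d, -, rfl, rfl⟩ := h
      obtain ⟨d', h1, h2⟩ := ih
      exact ⟨rev d, rfl, by rw [component_vert_rev, ← G.component_eq_of_face_eq h1, h2]⟩

/-- By Euler's formula, a tree and a cotree exhaust the edges of a component. -/
theorem isTreeEdge_or_isTreeEdge [Finite E] {K : G.Component}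
    (hE : Nat.card {v : V // G.component v = K}
      + Nat.card {F : G.Face // ∃ d, G.face d = F ∧ G.component (G.vert d) = K}
      = Nat.card {e : E // G.component (G.vert (e, false)) = K} + 2)
    {S : Set V} (hS : S = {v | G.component v = K}) {v₀ : V} (hv₀ : v₀ ∈ S) {A : E → Prop}
    (t : RootedSpanningTree G.vert S v₀ A) {S' : Set G.Face}
    (hS' : S' = {F | ∃ d, G.face d = F ∧ G.component (G.vert d) = K}) {f₀ : G.Face} (hf₀ : f₀ ∈ S')
    (t' : RootedSpanningTree G.face S' f₀ fun e => ¬ t.IsTreeEdge e) {e : E}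
    (he : G.component (G.vert (e, false)) = K) : t.IsTreeEdge e ∨ t'.IsTreeEdge e := by
  classical
  have := G.finite_vertices
  have := Fintype.ofFinite V
  have := Fintype.ofFinite E
  have := Fintype.ofFinite G.Face
  let X : Finset V := (Finset.univ.filter (· ∈ S)).erase v₀
  let Y : Finset G.Face := (Finset.univ.filter (· ∈ S')).erase f₀
  let Z : Finset E := Finset.univ.filter fun e => G.component (G.vert (e, false)) = K
  let X' := X.image fun v => (t.par v).1
  let Y' := Y.image fun f => (t'.par f).1
  have memX : ∀ v, v ∈ X ↔ v ∈ S ∧ v ≠ v₀ := fun v => by simp [X, and_comm]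
  have memY : ∀ f, f ∈ Y ↔ f ∈ S' ∧ f ≠ f₀ := fun v => by simp [Y, and_comm]
  have cX : X'.card = X.card := Finset.card_image_of_injOn fun a ha b hb hab => by
    rw [Finset.mem_coe, memX] at ha hb
    exact t.par_injective ha.1 ha.2 hb.1 hb.2 hab
  have cY : Y'.card = Y.card := Finset.card_image_of_injOn fun a ha b hb hab => by
    rw [Finset.mem_coe, memY] at ha hb
    exact t'.par_injective ha.1 ha.2 hb.1 hb.2 hab
  have cX2 : X.card + 1 = Nat.card {v : V // G.component v = K} := by
    rw [Finset.card_erase_add_one (by simpa using hv₀), Nat.card_eq_fintype_card,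
      Fintype.card_subtype, hS]
    rfl
  have cY2 : Y.card + 1 =
      Nat.card {F : G.Face // ∃ d, G.face d = F ∧ G.component (G.vert d) = K} := by
    rw [Finset.card_erase_add_one (by simpa using hf₀), Nat.card_eq_fintype_card,
      Fintype.card_subtype, hS']
    congr
  have cZ : Z.card = Nat.card {e : E // G.component (G.vert (e, false)) = K} := by
    rw [Nat.card_eq_fintype_card, Fintype.card_subtype]
  have hdisj : Disjoint X' Y' := by
    rw [Finset.disjoint_left]
    intro e h1 h2
    obtain ⟨v, hv, rfl⟩ := Finset.mem_image.1 h1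
    obtain ⟨f, hf, hfe⟩ := Finset.mem_image.1 h2
    rw [memX] at hv
    rw [memY] at hf
    exact t'.allowed f hf.1 hf.2 ⟨v, hv.1, hv.2, hfe.symm⟩
  have hsub : X' ∪ Y' ⊆ Z := by
    intro e he
    rw [Finset.mem_filter]
    refine ⟨Finset.mem_univ _, ?_⟩
    rcases Finset.mem_union.1 he with he | he
    · obtain ⟨v, hv, rfl⟩ := Finset.mem_image.1 he
      rw [memX] at hv
      have h1 := hv.1
      rw [hS, ← t.node_par v hv.1 hv.2] at h1
      exact (G.component_vert_false _).trans h1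
    · obtain ⟨f, hf, rfl⟩ := Finset.mem_image.1 he
      rw [memY] at hf
      have h1 := hf.1
      rw [hS'] at h1
      obtain ⟨d, hd, hd'⟩ := h1
      rw [← hd']
      refine (G.component_vert_false _).trans ?_
      exact G.component_eq_of_face_eq ((t'.node_par f hf.1 hf.2).trans hd.symm)
  -- The tree has one edge fewer than there are vertices, the cotree one fewer than there are faces;
  -- by Euler's formula these disjoint sets together have as many elements as `Z`.
  have heq : X' ∪ Y' = Z := by
    refine Finset.eq_of_subset_of_card_le hsub ?_
    rw [Finset.card_union_of_disjoint hdisj]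
    omega
  have he' : e ∈ X' ∪ Y' := by rw [heq]; simpa [Z] using he
  rcases Finset.mem_union.1 he' with he | he
  · obtain ⟨v, hv, rfl⟩ := Finset.mem_image.1 he
    rw [memX] at hv
    exact Or.inl ⟨v, hv.1, hv.2, rfl⟩
  · obtain ⟨f, hf, rfl⟩ := Finset.mem_image.1 he
    rw [memY] at hf
    exact Or.inr ⟨f, hf.1, hf.2, rfl⟩

/-- A function on the darts of a spherical component with values in a group that is a difference
along every face but two is, up to a gauge transformation, contained in a cyclic subgroup. -/
theorem exists_gauge [Finite E] {Γ : Type*} [Group Γ] (g : E × Bool → Γ)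
    (hg : ∀ d, g (rev d) = (g d)⁻¹) (d₀ : E × Bool)
    (hE : Nat.card {v : V // G.component v = G.component (G.vert d₀)}
      + Nat.card {F : G.Face // ∃ d, G.face d = F ∧
          G.component (G.vert d) = G.component (G.vert d₀)}
      = Nat.card {e : E // G.component (G.vert (e, false)) = G.component (G.vert d₀)} + 2)
    (f₁ : G.Face)
    (hp : ∀ d, G.component (G.vert d) = G.component (G.vert d₀) → G.face d ≠ G.face d₀ →
      G.face d ≠ f₁ → ∃ p : E × Bool → Γ, ∀ d', G.face d' = G.face d →
        g d' = p (G.facePerm d') * (p d')⁻¹) :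
    ∃ (h : V → Γ) (γ : Γ), (f₁ = G.face d₀ → γ = 1) ∧
      ∀ d, G.component (G.vert d) = G.component (G.vert d₀) →
        ∃ m : ℤ, g d = h (G.vert (rev d)) * γ ^ m * (h (G.vert d))⁻¹ := by
  classical
  have := G.finite_vertices
  have : Nonempty E := ⟨d₀.1⟩
  obtain ⟨t⟩ := G.exists_tree (G.vert d₀)
  obtain ⟨t'⟩ := G.exists_cotree (d₀ := d₀) t
  obtain ⟨h, hh⟩ := t.exists_gauge g
  let g' : E × Bool → Γ := fun d => (h (G.vert (rev d)))⁻¹ * g d * h (G.vert d)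
  have hg' : ∀ d, g' (rev d) = (g' d)⁻¹ := fun d => by
    simp only [g', hg, rev_rev]; group
  -- After gauging along the tree only cotree edges matter. The one from `f₁` towards the root is
  -- the only one not determined modulo the others, so its value is the generator.
  let γ : Γ := if f₁ = G.face d₀ then 1 else g' (t'.par f₁)
  let H := Subgroup.zpowers γ
  have hdart : ∀ {d d' : E × Bool}, d.1 = d'.1 → g' d' ∈ H → g' d ∈ H := by
    intro d d' hd h1
    rcases eq_or_eq_rev_of_fst_eq hd with rfl | rfl
    · exact h1
    · rw [hg']; exact H.inv_mem h1
  have key : ∀ e, G.component (G.vert (e, false)) = G.component (G.vert d₀) →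
      g' (e, false) ∈ H := by
    refine t'.prune (fun e he hK => ?_) fun f hf hf' hpar hK => ?_
    · obtain ⟨v, hv, hv', rfl⟩ :=
        (G.isTreeEdge_or_isTreeEdge hE rfl (by rfl) t rfl ⟨d₀, rfl, rfl⟩ t' hK).resolve_right he
      refine hdart (d' := t.par v) rfl ?_
      have : g' (t.par v) = 1 := by
        simp only [g', hh v hv hv', t.node_par v hv hv']; group
      rw [this]; exact H.one_mem
    · refine hdart (d' := t'.par f) rfl ?_
      by_cases hf₁ : f = f₁
      · subst hf₁
        have : γ = g' (t'.par f) := if_neg hf'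
        rw [← this]; exact Subgroup.mem_zpowers γ
      have hnode := t'.node_par f hf hf'
      obtain ⟨p, hp⟩ := hp (t'.par f) ((G.component_vert_false _).symm.trans hK)
        (by rw [hnode]; exact hf') (by rw [hnode]; exact hf₁)
      let p' : E × Bool → Γ := fun d => (h (G.vert d))⁻¹ * p d
      have hp' : ∀ d, G.face d = f → g' d = p' (G.facePerm d) * (p' d)⁻¹ := fun d hd => by
        simp only [g', p', hp d (hd.trans hnode.symm), vert_facePerm]; group
      rw [hp' _ hnode]
      -- On this face `g'` is a difference of `p'`. All boundary edges but the parent already have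
      -- values in `H`, hence so does the parent.
      refine Equiv.Perm.rel_apply_of_forall_ne G.facePerm (r := fun d d' => p' d' * (p' d)⁻¹ ∈ H)
        ⟨fun d => by simp, fun {d d'} hd => by simpa using H.inv_mem hd,
          fun {a b c} h1 h2 => by simpa [mul_assoc] using H.mul_mem h2 h1⟩ _ fun d hd hne => ?_
      have hdf : G.face d = f := by rw [← hnode, eq_comm, face_eq_iff]; exact hd
      rw [← hp' d hdf]
      refine hdart (d' := (d.1, false)) rfl (hpar d hdf hne ?_)
      exact (G.component_vert_false d).trans
        ((G.component_eq_of_face_eq (hdf.trans hnode.symm)).trans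
          ((G.component_vert_false _).symm.trans hK))
  refine ⟨h, γ, fun h1 => if_pos h1, fun d hd => ?_⟩
  have h1 : g' d ∈ H := hdart (d' := (d.1, false)) rfl
    (key _ ((G.component_vert_false d).trans hd))
  obtain ⟨m, hm⟩ := Subgroup.mem_zpowers_iff.1 h1
  refine ⟨m, ?_⟩
  rw [hm]
  simp only [g']; group

end PeriodicGraph

/-! ### Exactness on the covering of a spherical component -/

/-- The affine transformations `(k, t) ↦ (k + level, t + val k)` of `ℤ × M`. -/
@[ext]
structure LevelShift (M : Type*) where
  val : ℤ → M
  level : ℤ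

namespace LevelShift

variable {M : Type*} [AddCommGroup M]

/-- Composition of transformations, the right factor acting first. The group is not commutative: a
shift of level also shifts the argument of later increments. -/
instance : Mul (LevelShift M) :=
  ⟨fun g h => ⟨fun k => h.val k + g.val (k + h.level), g.level + h.level⟩⟩

instance : One (LevelShift M) := ⟨⟨0, 0⟩⟩

instance : Inv (LevelShift M) := ⟨fun g => ⟨fun k => - g.val (k - g.level), - g.level⟩⟩

@[simp] theorem val_mul (g h : LevelShift M) (k : ℤ) :
    (g * h).val k = h.val k + g.val (k + h.level) := rfl

@[simp] theorem level_mul (g h : LevelShift M) : (g * h).level = g.level + h.level := rfl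

@[simp] theorem val_one (k : ℤ) : (1 : LevelShift M).val k = 0 := rfl

@[simp] theorem level_one : (1 : LevelShift M).level = 0 := rfl

@[simp] theorem val_inv (g : LevelShift M) (k : ℤ) : g⁻¹.val k = - g.val (k - g.level) := rfl

@[simp] theorem level_inv (g : LevelShift M) : g⁻¹.level = - g.level := rfl

instance : Group (LevelShift M) :=
  Group.ofLeftAxioms
    (fun a b c => by
      ext k
      · simp only [val_mul, level_mul, add_assoc, add_comm c.level]
      · simp only [level_mul, add_assoc])
    (fun a => by ext k <;> simp)
    (fun a => by ext k <;> simp)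

@[simp] theorem level_zpow (g : LevelShift M) (m : ℤ) : (g ^ m).level = m * g.level := by
  let φ : LevelShift M →* Multiplicative ℤ :=
    ⟨⟨fun g => .ofAdd g.level, rfl⟩, fun _ _ => rfl⟩
  have h := congrArg Multiplicative.toAdd (map_zpow φ g m)
  rw [toAdd_zpow, smul_eq_mul] at h
  exact h

end LevelShift

namespace PeriodicGraph

variable {V E : Type*} [Fintype E] (G : PeriodicGraph V E)

/-- A face whose boundary is not winding has a height function. -/
theorem exists_faceHeight {d : E × Bool} (h : G.faceVolt d = 0) :
    ∃ n : E × Bool → ℤ, ∀ d', G.face d' = G.face d → n (G.facePerm d') = n d' + G.dartVolt d' :=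
  G.facePerm.exists_potential G.dartVolt d (fun _ => G.face_eq_iff) h

/-- A function on the lifts of the darts that is invariant along the lifts of a boundary walk is
periodic. -/
theorem apply_add_faceVolt {A : Type*} (b : E × Bool → ℤ → A) (d : E × Bool)
    (h : ∀ d', G.face d' = G.face d → ∀ k, b (G.facePerm d') (k + G.dartVolt d') = b d' k) (k : ℤ) :
    b d (k + G.faceVolt d) = b d k := by
  classical
  have key : ∀ i : ℕ, b ((G.facePerm ^ i) d)
      (k + ∑ j ∈ Finset.range i, G.dartVolt ((G.facePerm ^ j) d)) = b d k := by
    intro i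
    induction i with
    | zero => simp
    | succ i ih =>
      rw [Finset.sum_range_succ, ← add_assoc, pow_succ' G.facePerm, Equiv.Perm.mul_apply, h, ih]
      exact G.face_eq_iff.2 (Equiv.Perm.SameCycle.symm ⟨(i : ℕ), by rw [zpow_natCast]⟩)
  have h1 := key (Function.minimalPeriod G.facePerm d)
  rw [Equiv.Perm.coe_pow, Function.iterate_minimalPeriod] at h1
  rw [faceVolt, G.facePerm.sum_sameCycle _ d fun _ => G.face_eq_iff]
  exact h1

/-- Voltages that are multiples of `c` up to a coboundary have winding numbers divisible by `c`. -/
theorem dvd_faceVolt {c : ℤ} {d : E × Bool} (n : V → ℤ)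
    (h : ∀ d', G.face d' = G.face d →
      c ∣ G.dartVolt d' - (n (G.vert (rev d')) - n (G.vert d'))) : c ∣ G.faceVolt d := by
  classical
  have h1 : G.faceVolt d = ∑ d', if G.face d' = G.face d then
      G.dartVolt d' - (n (G.vert (rev d')) - n (G.vert d')) else 0 := by
    have h2 : (∑ d', if G.face d' = G.face d then n (G.vert d') else 0)
        = ∑ d', if G.face d' = G.face d then n (G.vert (rev d')) else 0 := by
      rw [← Equiv.sum_comp G.facePerm]
      simp only [face_facePerm, vert_facePerm]
    rw [← sub_eq_zero, faceVolt, ← Finset.sum_sub_distrib, ← sub_eq_zero.2 h2.symm,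
      ← Finset.sum_sub_distrib]
    refine Finset.sum_congr rfl fun d' _ => ?_
    split_ifs <;> ring
  rw [h1]
  refine Finset.dvd_sum fun d' _ => ?_
  split_ifs with h2
  · exact h d' h2
  · exact dvd_zero c

variable {G}

/-- If the Laplacian polynomial does not vanish, then every component winds around the annulus. -/
theorem exists_faceVolt_ne_zero [Fintype V] (hG : G.IsPlane) (hΔ : G.laplacianPoly ≠ 0)
    (K : G.Component) : ∃ d, G.component (G.vert d) = K ∧ G.faceVolt d ≠ 0 := by
  by_contra! hK
  obtain ⟨v, hv⟩ : ∃ v, G.component v = K := Quot.exists_rep K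
  obtain ⟨d₀, rfl⟩ := G.vert_surjective v
  subst hv
  obtain ⟨h, γ, hγ, hh⟩ := G.exists_gauge (Γ := Multiplicative ℤ)
    (fun d => .ofAdd (G.dartVolt d)) (fun d => by simp) d₀ (hG.euler _) (G.face d₀)
    fun d hd _ _ => by
      obtain ⟨n, hn⟩ := G.exists_faceHeight (hK d hd)
      refine ⟨fun d => .ofAdd (n d), fun d' hd' => ?_⟩
      simp only [hn d' hd', ofAdd_add]
      rw [mul_inv_cancel_comm]
  refine hΔ (G.laplacianPoly_eq_zero (G.component (G.vert d₀)) ⟨_, rfl⟩ (fun v => (h v).toAdd)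
    fun d hd => ?_)
  obtain ⟨m, hm⟩ := hh d hd
  rw [hγ rfl, one_zpow, mul_one] at hm
  have := congrArg Multiplicative.toAdd hm
  simpa [sub_eq_add_neg] using this

variable {M : Type*} [AddCommGroup M]

/-- On the covering of a component that winds around the annulus, a function on the corners that is
closed at the edges is the sum of a function on the vertices and a function on the faces.  The
latter may be assumed to vanish on an unbounded face. -/
theorem exists_primitive (hG : G.IsPlane) {d₀ : E × Bool} (hd₀ : G.faceVolt d₀ ≠ 0)
    {C : E × Bool → ℤ → M}
    (hC : ∀ d k, C (rev d) (k + G.dartVolt d) + C d k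
      = C (G.rot.symm d) k + C (G.facePerm d) (k + G.dartVolt d)) :
    ∃ a : V → ℤ → M, (∀ k, a (G.vert d₀) k = C d₀ k) ∧
      ∀ d, G.component (G.vert d) = G.component (G.vert d₀) → ∀ k,
        a (G.vert (rev d)) (k + G.dartVolt d) - a (G.vert d) k
          = C (G.facePerm d) (k + G.dartVolt d) - C d k := by
  classical
  -- The increment that the vertex function must have along each lift of `d`, bundled with the
  -- voltage. Closedness of `C` at the edges is exactly compatibility with reversal.
  let g : E × Bool → LevelShift M := fun d =>
    ⟨fun k => C (G.facePerm d) (k + G.dartVolt d) - C d k, G.dartVolt d⟩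
  have hg : ∀ d, g (rev d) = (g d)⁻¹ := fun d => by
    ext k
    · have h := hC d (k - G.dartVolt d)
      rw [sub_add_cancel] at h
      simp only [g, LevelShift.val_inv, dartVolt_rev, facePerm_apply, rev_rev, sub_add_cancel,
        ← sub_eq_add_neg] at h ⊢
      rw [neg_sub, sub_eq_sub_iff_add_eq_add, add_comm (C d _), h]
    · simp [g]
  have hunit : ∀ d, G.faceVolt d ≠ 0 → G.faceVolt d = 1 ∨ G.faceVolt d = -1 := fun d hd => by
    have h1 := abs_le.1 (hG.abs_faceVolt_le d)
    omega
  -- Besides the face of `d₀`, only a face of opposite winding can wind. If there is none, `f₁` is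
  -- the face of `d₀` again.
  obtain ⟨f₁, hf₁⟩ : ∃ f₁ : G.Face, ∀ d, G.component (G.vert d) = G.component (G.vert d₀) →
      G.face d ≠ G.face d₀ → G.face d ≠ f₁ → G.faceVolt d = 0 := by
    by_cases hex : ∃ d₁, G.component (G.vert d₁) = G.component (G.vert d₀) ∧
        G.faceVolt d₁ = - G.faceVolt d₀
    · obtain ⟨d₁, h1, h2⟩ := hex
      refine ⟨G.face d₁, fun d hd hne hne' => ?_⟩
      by_contra h0
      by_cases heq : G.faceVolt d = G.faceVolt d₀
      · exact hne (hG.face_eq d d₀ hd heq h0)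
      · refine hne' (hG.face_eq d d₁ (hd.trans h1.symm) ?_ h0)
        have := hunit d h0
        have := hunit d₀ hd₀
        omega
    · refine ⟨G.face d₀, fun d hd hne _ => ?_⟩
      by_contra h0
      by_cases heq : G.faceVolt d = G.faceVolt d₀
      · exact hne (hG.face_eq d d₀ hd heq h0)
      · refine hex ⟨d, hd, ?_⟩
        have := hunit d h0
        have := hunit d₀ hd₀
        omega
  obtain ⟨h, γ, -, hh⟩ := G.exists_gauge g hg d₀ (hG.euler _) f₁ fun d hd hne hne' => by
    obtain ⟨n, hn⟩ := G.exists_faceHeight (hf₁ d hd hne hne')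
    -- The boundary of a non-winding face lifts to closed walks, with heights `n`; along them `C`
    -- itself is a potential.
    refine ⟨fun d => ⟨fun k => C d (k + n d), n d⟩, fun d' hd' => ?_⟩
    ext k
    · simp only [g, LevelShift.val_mul, LevelShift.val_inv, LevelShift.level_inv, hn d' hd',
        sub_add_cancel]
      rw [show k + -n d' + (n d' + G.dartVolt d') = k + G.dartVolt d' by ring]
      abel
    · simp only [g, LevelShift.level_mul, LevelShift.level_inv, hn d' hd']; ring
  -- Up to a coboundary the voltages are multiples of `γ.level`, which therefore divides the winding
  -- number `±1` of the face of `d₀`.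
  have hlevel : γ.level * γ.level = 1 := by
    have h1 : γ.level ∣ G.faceVolt d₀ := by
      refine G.dvd_faceVolt (fun v => (h v).level) fun d' hd' => ?_
      obtain ⟨m, hm⟩ := hh d' (G.component_eq_of_face_eq hd')
      have h2 := congrArg LevelShift.level hm
      simp only [LevelShift.level_mul, LevelShift.level_inv, LevelShift.level_zpow, g] at h2
      exact ⟨m, by rw [h2]; ring⟩
    have h2 : IsUnit γ.level := isUnit_of_dvd_unit h1 (Int.isUnit_iff.2 (hunit _ hd₀))
    rcases Int.isUnit_iff.1 h2 with h3 | h3 <;> rw [h3] <;> rfl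
  let δ : LevelShift M := γ ^ γ.level
  have hγδ : ∀ m : ℤ, γ ^ m = δ ^ (γ.level * m) := fun m => by
    simp only [δ]
    rw [← zpow_mul, ← mul_assoc, hlevel, one_mul]
  have hδ : ∀ m : ℤ, (δ ^ m).level = m := fun m => by
    rw [LevelShift.level_zpow]
    simp only [δ]
    rw [LevelShift.level_zpow, hlevel, mul_one]
  -- Since `δ` raises the level by exactly one, the orbit of `(0, 0)` under its powers is the graph
  -- of a function `a₀`, and its increments integrate `δ`.
  let a₀ : ℤ → M := fun k => (δ ^ k).val 0
  have ha₀ : ∀ m k, a₀ (k + m) = a₀ k + (δ ^ m).val k := fun m k => by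
    simp only [a₀]
    rw [add_comm k m, zpow_add, LevelShift.val_mul, hδ, zero_add]
  let a : V → ℤ → M := fun v k => (h v).val (k - (h v).level) + a₀ (k - (h v).level)
  have ha : ∀ d, G.component (G.vert d) = G.component (G.vert d₀) → ∀ k,
      a (G.vert (rev d)) (k + G.dartVolt d) - a (G.vert d) k
          = C (G.facePerm d) (k + G.dartVolt d) - C d k := by
    intro d hd k
    obtain ⟨m, hm⟩ := hh d hd
    rw [hγδ, eq_mul_inv_iff_mul_eq] at hm
    have h1 := congrArg LevelShift.level hm
    have h2 := congrFun (congrArg LevelShift.val hm) (k - (h (G.vert d)).level)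
    simp only [LevelShift.level_mul, LevelShift.val_mul, hδ, g, sub_add_cancel] at h1 h2
    have h3 : k + G.dartVolt d - (h (G.vert (rev d))).level
        = k - (h (G.vert d)).level + γ.level * m := by linarith
    simp only [a]
    rw [h3, ha₀]
    rw [← sub_eq_zero] at h2 ⊢
    rw [← neg_eq_zero, ← h2]
    abel
  -- Along the face of `d₀` the difference `a - C` is invariant. This boundary winds once, so the
  -- difference has period one in the level and is a constant that can be subtracted.
  have hb : ∀ k, a (G.vert d₀) k - C d₀ k = a (G.vert d₀) 0 - C d₀ 0 := by
    have h1 := G.apply_add_faceVolt (fun d k => a (G.vert d) k - C d k) d₀ fun d hd k => by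
      have := ha d (G.component_eq_of_face_eq hd) k
      rw [vert_facePerm]
      rw [sub_eq_sub_iff_add_eq_add] at this ⊢
      rw [this]
      abel
    have h2 : ∀ k, a (G.vert d₀) (k + 1) - C d₀ (k + 1) = a (G.vert d₀) k - C d₀ k := by
      rcases hunit d₀ hd₀ with h3 | h3 <;> rw [h3] at h1
      · exact h1
      · intro k
        have := h1 (k + 1)
        rw [add_neg_cancel_right] at this
        exact this.symm
    intro k
    induction k using Int.induction_on with
    | zero => rfl
    | succ i ih => rw [h2, ih]
    | pred i ih => rw [← ih, ← h2 (-i - 1), sub_add_cancel]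
  refine ⟨fun v k => a v k - (a (G.vert d₀) 0 - C d₀ 0), fun k => ?_, fun d hd k => ?_⟩
  · simp only [← hb k, sub_sub_cancel]
  · rw [sub_sub_sub_cancel_right, ha d hd k]

/-- A function on the corners of the covering that is closed at the edges and harmonic vanishes if
it is small with respect to a filter such that the Laplacian polynomial acts injectively on small
sequences. -/
theorem eq_zero_of_eventually [Fintype V] (hG : G.IsPlane) (hΔ : G.laplacianPoly ≠ 0)
    {C : E × Bool → ℤ → M}
    (hC : ∀ d k, C (rev d) (k + G.dartVolt d) + C d k
      = C (G.rot.symm d) k + C (G.facePerm d) (k + G.dartVolt d))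
    (hS : ∀ d k, (G.sign d.1 : ℤ) • (C (G.facePerm d) (k + G.dartVolt d) - C d k)
      = C d k - C (G.rot.symm d) k)
    {l : Filter ℤ} (hl : ∀ n, Filter.Tendsto (· + n) l l) (hCl : ∀ d, ∀ᶠ k in l, C d k = 0)
    (hinj : ∀ a : ℤ → M, LaurentPolynomial.shiftAction M G.laplacianPoly a = 0 →
      (∀ᶠ k in l, a k = 0) → a = 0) (d : E × Bool) (k : ℤ) : C d k = 0 := by
  classical
  choose d₀ hd₀ hvolt using exists_faceVolt_ne_zero hG hΔ
  choose a ha₀ ha using fun K => exists_primitive hG (hvolt K) hC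
  let A : V → ℤ → M := fun v => a (G.component v) v
  have hA : ∀ d k, A (G.vert (rev d)) (k + G.dartVolt d) - A (G.vert d) k
      = C (G.facePerm d) (k + G.dartVolt d) - C d k := fun d k => by
    simp only [A, component_vert_rev]
    exact ha _ d (hd₀ _).symm k
  have hA₀ : ∀ K k, A (G.vert (d₀ K)) k = C (d₀ K) k := fun K k => by
    simp only [A, hd₀]; exact ha₀ K k
  have hLA : ∀ i, ∑ j, LaurentPolynomial.shiftAction M (G.laplacian i j) (A j) = 0 := by
    intro i
    funext k
    rw [sum_shiftAction_laplacian]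
    have h1 : ∀ d, (if G.vert d = i then
          (G.sign d.1 : ℤ) • (A i k - A (G.vert (rev d)) (k + G.dartVolt d)) else 0)
        = (if G.vert (G.rot.symm d) = i then C (G.rot.symm d) k else 0)
          - (if G.vert d = i then C d k else 0) := fun d => by
      rw [vert_rot_symm]
      split_ifs with hd
      · subst hd
        rw [← neg_sub, hA, smul_neg, hS, neg_sub]
      · rw [sub_zero]
    -- The summand is now a difference of consecutive corners around the vertex `i`, so the sum
    -- telescopes.
    simp only [h1]
    rw [Finset.sum_sub_distrib, Equiv.sum_comp G.rot.symm
      (fun d => if G.vert d = i then C d k else 0), sub_self]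
    rfl
  -- Here the normalization at `d₀` matters: there `A` equals `C` and is small; smallness then
  -- spreads along the edges, since the increments of `A` are differences of `C`.
  have hAl : ∀ v, ∀ᶠ k in l, A v k = 0 := by
    intro v
    refine component_induction (Q := fun v => ∀ᶠ k in l, A v k = 0) (fun d hd => ?_)
      (hd₀ (G.component v)) ?_
    · have h1 : ∀ᶠ k in l, A (G.vert (rev d)) (k + G.dartVolt d) = 0 := by
        filter_upwards [hd, hCl d, (hl (G.dartVolt d)).eventually (hCl (G.facePerm d))]
          with k h1 h2 h3
        have := hA d k
        rwa [h1, h2, h3, sub_zero, sub_zero] at this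
      filter_upwards [(hl (-G.dartVolt d)).eventually h1] with k h2
      rwa [neg_add_cancel_right] at h2
    · filter_upwards [hCl (d₀ (G.component v))] with k hk
      rw [hA₀, hk]
  have hA0 : ∀ v, A v = 0 := fun v =>
    hinj _ (LaurentPolynomial.shiftAction_det G.laplacian A hLA v) (hAl v)
  -- With `A = 0`, colors are constant along faces and, by `hS`, around vertices; they agree with
  -- `A` at `d₀`, so they vanish throughout the component.
  have hface : ∀ d k, C (G.facePerm d) (k + G.dartVolt d) = C d k := fun d k => by
    have := hA d k
    rw [hA0, hA0] at this
    exact sub_eq_zero.1 (this.symm.trans (sub_self _))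
  have hrot : ∀ d, C d = C (G.rot.symm d) := fun d => by
    funext k
    have := hS d k
    rw [hface, sub_self, smul_zero] at this
    exact (sub_eq_zero.1 this.symm)
  have hvert : ∀ d d', G.vert d = G.vert d' → C d = C d' := fun d d' h =>
    Equiv.Perm.SameCycle.rel (r := fun d d' => C d = C d')
      ⟨fun _ => rfl, Eq.symm, Eq.trans⟩ (Equiv.Perm.sameCycle_inv.2 ((G.vert_eq_iff _ _).1 h))
      fun d _ => hrot d
  have hzero : ∀ d, C d = 0 := by
    intro d
    refine component_induction (Q := fun v => ∀ d, G.vert d = v → C d = 0) (fun d hd d' hd' => ?_)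
      (hd₀ (G.component (G.vert d))) (fun d' hd' => ?_) d rfl
    · rw [hvert d' (G.facePerm d) (hd'.trans (G.vert_facePerm d).symm)]
      funext k
      have := hface d (k - G.dartVolt d)
      rw [sub_add_cancel, hd d rfl] at this
      exact this
    · rw [hvert _ _ hd']
      funext k
      rw [← hA₀, hA0]
  rw [hzero]; rfl

end PeriodicGraph

/-! ### Integral linear systems over the circle -/

instance : Infinite UnitAddCircle := by
  have : Infinite (Set.Ico (0 : ℝ) (0 + 1)) := (Set.Ico_infinite (by norm_num)).to_subtype
  exact Infinite.of_injective _ (AddCircle.equivIco (1 : ℝ) 0).symm.injective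

/-- A square integral linear system over the circle whose homogeneous system has only finitely many
solutions is solvable. -/
theorem UnitAddCircle.exists_solution {R C : Type*} [Fintype R] [Fintype C] (A : Matrix R C ℤ)
    (hcard : Fintype.card R = Fintype.card C)
    (hfin : {x : C → UnitAddCircle | ∀ r, ∑ c, A r c • x c = 0}.Finite) (y : R → UnitAddCircle) :
    ∃ x : C → UnitAddCircle, ∀ r, ∑ c, A r c • x c = y r := by
  classical
  let e := Fintype.equivOfCardEq hcard
  let B : Matrix C C ℤ := A.submatrix e.symm id
  have hdet : B.det ≠ 0 := by
    intro h0
    obtain ⟨v, hv, hBv⟩ := Matrix.exists_mulVec_eq_zero_iff.2 h0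
    obtain ⟨c₀, hc₀⟩ := Function.ne_iff.1 hv
    -- An integral kernel vector, scaled by circle elements, yields homogeneous solutions whose
    -- coordinate at `c₀` takes every value `z`.
    refine Set.infinite_univ (α := UnitAddCircle) ((hfin.image fun x => x c₀).subset fun z _ => ?_)
    refine ⟨fun c => v c • DivisibleBy.div z (v c₀), fun r => ?_, DivisibleBy.div_cancel z hc₀⟩
    have := congrFun hBv (e r)
    simp only [Matrix.mulVec, dotProduct, B, Matrix.submatrix_apply, Equiv.symm_apply_apply, id,
      Pi.zero_apply] at this
    simp only [smul_smul]
    rw [← Finset.sum_smul, this, zero_smul]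
  refine ⟨fun c => ∑ c', B.adjugate c c' • DivisibleBy.div (y (e.symm c')) B.det, fun r => ?_⟩
  have h1 : ∀ c', ∑ c, A r c * B.adjugate c c' = if e r = c' then B.det else 0 := fun c' => by
    have := congrFun (congrFun B.mul_adjugate (e r)) c'
    simpa [Matrix.mul_apply, B, Matrix.one_apply] using this
  simp only [Finset.smul_sum, smul_smul]
  rw [Finset.sum_comm]
  simp only [← Finset.sum_smul, h1, ite_smul, zero_smul]
  rw [Finset.sum_ite_eq Finset.univ (e r), if_pos (Finset.mem_univ _), DivisibleBy.div_cancel _ hdet,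
    Equiv.symm_apply_apply]

/-! ### Colorings of strands -/

namespace CrossingDiagram

variable {S X : Type*} {M : Type*} [AddCommGroup M] (D : CrossingDiagram S X)

/-- A coloring, as a function on the strands. -/
def IsStrandColoring (s : S → M) : Prop :=
  ∀ x, s (D.over₁ x) = s (D.over₂ x) ∧ 2 • s (D.over₁ x) = s (D.under₁ x) + s (D.under₂ x)

variable {D}

theorem IsStrandColoring.zero : D.IsStrandColoring (0 : S → M) := fun _ => by simp

theorem IsStrandColoring.sub {s t : S → M} (hs : D.IsStrandColoring s)
    (ht : D.IsStrandColoring t) : D.IsStrandColoring (s - t) := fun x => by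
  refine ⟨?_, ?_⟩
  · rw [Pi.sub_apply, Pi.sub_apply, (hs x).1, (ht x).1]
  · simp only [Pi.sub_apply, smul_sub, (hs x).2, (ht x).2]; abel

theorem Coloring.isStrandColoring (c : D.Coloring) :
    D.IsStrandColoring fun s => c.1 (D.arc s) := fun x =>
  ⟨congrArg c.1 (Quot.sound ⟨x, rfl, rfl⟩), c.2 x⟩

theorem Coloring.ext_strand {c c' : D.Coloring} (h : ∀ s, c.1 (D.arc s) = c'.1 (D.arc s)) :
    c = c' :=
  Subtype.ext (funext fun a => Quot.ind (β := fun a => c.1 a = c'.1 a) h a)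

/-- The coloring of the arcs given by a coloring of the strands. -/
def Coloring.ofStrand {s : S → UnitAddCircle} (hs : D.IsStrandColoring s) : D.Coloring :=
  ⟨Quot.lift s fun _ _ ⟨x, h₁, h₂⟩ => by rw [← h₁, ← h₂]; exact (hs x).1, fun x => (hs x).2⟩

end CrossingDiagram

namespace PeriodicGraph

open CrossingDiagram

variable {V E : Type*} {G : PeriodicGraph V E} {M : Type*} [AddCommGroup M]

/-- The conditions for a coloring of the medial diagram at an edge, as seen from one of its ends. -/
theorem medial_coloring_at_dart {C : (E × Bool) × ℤ → M} (hC : G.medial.IsStrandColoring C)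
    (d : E × Bool) (k : ℤ) :
    (G.sign d.1 = 1 → C (d, k) = C (rev d, k + G.dartVolt d) ∧
      2 • C (d, k) = C (G.rot.symm d, k) + C (G.facePerm d, k + G.dartVolt d)) ∧
    (G.sign d.1 ≠ 1 → C (G.rot.symm d, k) = C (G.facePerm d, k + G.dartVolt d) ∧
      2 • C (G.rot.symm d, k) = C (d, k) + C (rev d, k + G.dartVolt d)) := by
  obtain ⟨e, b⟩ := d
  obtain ⟨h1, h2⟩ := hC (e, k - G.endLevel (e, b))
  cases b <;> by_cases hs : G.sign e = 1 <;>
    simp [medial, hs, endLevel, dartVolt, rev, facePerm, ← sub_eq_add_neg] at h1 h2 ⊢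
  · exact ⟨h1, h2⟩
  · exact ⟨h1, h2⟩
  · exact ⟨h1.symm, by rw [← h1, h2, add_comm]⟩
  · exact ⟨h1.symm, by rw [← h1, h2, add_comm]⟩

/-- The colorings of the medial diagram that are small with respect to a filter such that the
Laplacian polynomial acts injectively on small sequences vanish. -/
theorem medial_coloring_eq_zero [Fintype V] [Fintype E] (hG : G.IsPlane)
    (hΔ : G.laplacianPoly ≠ 0) {C : (E × Bool) × ℤ → M} (hC : G.medial.IsStrandColoring C)
    {l : Filter ℤ} (hl : ∀ n, Filter.Tendsto (· + n) l l)
    (hCl : ∀ d, ∀ᶠ k in l, C (d, k) = 0)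
    (hinj : ∀ a : ℤ → M, LaurentPolynomial.shiftAction M G.laplacianPoly a = 0 →
      (∀ᶠ k in l, a k = 0) → a = 0) (d : E × Bool) (k : ℤ) : C (d, k) = 0 := by
  refine eq_zero_of_eventually (C := fun d k => C (d, k)) hG hΔ (fun d k => ?_) (fun d k => ?_)
    hl hCl hinj d k
  · obtain ⟨h1, h2⟩ := medial_coloring_at_dart hC d k
    by_cases hs : G.sign d.1 = 1
    · rw [← (h1 hs).2, ← (h1 hs).1, two_nsmul]
    · rw [add_comm, ← (h2 hs).2, ← (h2 hs).1, two_nsmul]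
  · obtain ⟨h1, h2⟩ := medial_coloring_at_dart hC d k
    by_cases hs : G.sign d.1 = 1
    · rw [hs, Units.val_one, one_smul, eq_sub_of_add_eq' (h1 hs).2.symm, two_nsmul]
      abel
    · rw [(Int.units_eq_one_or (G.sign d.1)).resolve_left hs, ← (h2 hs).1]
      simp

namespace Position

variable (P : G.Position)

/-- The piece that meets the top of `R` at the point `i`. -/
def topPiece (i : P.CutPoint) : P.Piece :=
  if P.dir i.1 i.2 = 1 then ⟨i.1, i.2.castSucc⟩ else ⟨i.1, i.2.succ⟩

/-- The piece that meets the bottom of `R` at the point `i`. -/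
def bottomPiece (i : P.CutPoint) : P.Piece :=
  if P.dir i.1 i.2 = 1 then ⟨i.1, i.2.succ⟩ else ⟨i.1, i.2.castSucc⟩

theorem level_succ (d : E × Bool) (i : Fin (P.count d)) :
    P.level ⟨d, i.succ⟩ = P.level ⟨d, i.castSucc⟩ + P.dir d i := by
  have h : ∀ j : Fin (P.count d), (if j.castSucc < i.succ then (P.dir d j : ℤ) else 0)
      = (if j.castSucc < i.castSucc then (P.dir d j : ℤ) else 0)
        + if j = i then (P.dir d j : ℤ) else 0 := fun j => by
    rcases lt_trichotomy j i with h | rfl | h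
    · rw [if_pos (Fin.castSucc_lt_succ_iff.2 h.le), if_pos (Fin.castSucc_lt_castSucc_iff.2 h),
        if_neg h.ne, add_zero]
    · rw [if_pos (Fin.castSucc_lt_succ_iff.2 le_rfl), if_neg (lt_irrefl _), if_pos rfl, zero_add]
    · rw [if_neg fun h' => (Fin.castSucc_lt_succ_iff.1 h').not_gt h,
        if_neg fun h' => (Fin.castSucc_lt_castSucc_iff.1 h').not_gt h, if_neg h.ne', add_zero]
  simp only [level, h]
  rw [Finset.sum_add_distrib, Finset.sum_ite_eq' Finset.univ i, if_pos (Finset.mem_univ _)]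
  ring

theorem bottomPiece_fst (i : P.CutPoint) : (P.bottomPiece i).1 = (P.topPiece i).1 := by
  rw [bottomPiece, topPiece]; split_ifs <;> rfl

/-- At a cut point the two adjacent pieces lie on either side of the line, whichever way the strand
crosses it. This is the bookkeeping behind gluing translates of `R`. -/
theorem level_bottomPiece (i : P.CutPoint) :
    P.level (P.bottomPiece i) = P.level (P.topPiece i) + 1 := by
  rw [bottomPiece, topPiece]
  split_ifs with h
  · rw [level_succ, h, Units.val_one]
  · rw [level_succ, (Int.units_eq_one_or _).resolve_left h]; simp

/-- The strands of `D` at a crossing, in terms of the pieces of `D_0`. -/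
theorem medial_eq (e : E) (j : ℤ) :
    G.medial.over₁ (e, j)
      = ((P.tangle.over₁ e).1, j + P.height e - P.level (P.tangle.over₁ e)) ∧
    G.medial.over₂ (e, j)
      = ((P.tangle.over₂ e).1, j + P.height e - P.level (P.tangle.over₂ e)) ∧
    G.medial.under₁ (e, j)
      = ((P.tangle.under₁ e).1, j + P.height e - P.level (P.tangle.under₁ e)) ∧
    G.medial.under₂ (e, j)
      = ((P.tangle.under₂ e).1, j + P.height e - P.level (P.tangle.under₂ e)) := by
  obtain ⟨h1, h2, h3, h4⟩ := P.strandOf_tangle e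
  by_cases hs : G.sign e = 1 <;>
    simp only [strandOf, medial, hs, if_true, if_false, Prod.mk.injEq] at h1 h2 h3 h4 ⊢ <;>
    exact ⟨⟨h1.1.symm, by linarith [h1.2]⟩, ⟨h2.1.symm, by linarith [h2.2]⟩,
      ⟨h3.1.symm, by linarith [h3.2]⟩, ⟨h4.1.symm, by linarith [h4.2]⟩⟩

/-- The restriction of a coloring of `D` to a translate of `R` is a coloring of `D_0`. -/
theorem isStrandColoring_restrict {C : (E × Bool) × ℤ → M} (hC : G.medial.IsStrandColoring C)
    (m : ℤ) : P.tangle.IsStrandColoring fun p => C (p.1, m - P.level p) := fun e => by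
  have h := hC (e, m - P.height e)
  obtain ⟨h1, h2, h3, h4⟩ := P.medial_eq e (m - P.height e)
  rw [h1, h2, h3, h4, sub_add_cancel] at h
  exact h

/-- Colorings of the translates of `D_0` that match along the lines yield a coloring of `D`. -/
theorem exists_glue {c : ℤ → P.Piece → M} (hc : ∀ m, P.tangle.IsStrandColoring (c m))
    (hmatch : ∀ m i, c m (P.topPiece i) = c (m + 1) (P.bottomPiece i)) :
    ∃ C : (E × Bool) × ℤ → M, G.medial.IsStrandColoring C ∧
      ∀ p k, C (p.1, k) = c (k + P.level p) p := by
  let C : (E × Bool) × ℤ → M := fun s => c (s.2 + P.level ⟨s.1, 0⟩) ⟨s.1, 0⟩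
  have hC : ∀ (p : P.Piece) k, C (p.1, k) = c (k + P.level p) p := by
    -- The color is carried along the strand from piece to piece; each line crossing uses the
    -- matching condition, read upwards or downwards according to `dir`.
    rintro ⟨d, p⟩ k
    induction p using Fin.induction with
    | zero => rfl
    | succ i ih =>
      rw [ih, level_succ]
      by_cases h : P.dir d i = 1
      · have := hmatch (k + P.level ⟨d, i.castSucc⟩) ⟨d, i⟩
        rw [topPiece, bottomPiece, if_pos h, if_pos h] at this
        rw [this, h, Units.val_one, add_assoc]
      · have := hmatch (k + P.level ⟨d, i.castSucc⟩ - 1) ⟨d, i⟩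
        rw [topPiece, bottomPiece, if_neg h, if_neg h, sub_add_cancel] at this
        rw [← this, (Int.units_eq_one_or _).resolve_left h, Units.val_neg, Units.val_one,
          ← sub_eq_add_neg, add_sub_assoc]
  refine ⟨C, ?_, hC⟩
  rintro ⟨e, j⟩
  obtain ⟨h1, h2, h3, h4⟩ := P.medial_eq e j
  rw [h1, h2, h3, h4, hC, hC, hC, hC]
  simp only [sub_add_cancel]
  exact hc _ e

/-- If the coefficients of the Laplacian polynomial are coprime, then a coloring of `D_0` that
vanishes on the top and the bottom arcs vanishes. -/
theorem eq_zero_of_coprimeCoeffs [Fintype V] [Fintype E] (hG : G.IsPlane)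
    (hΔ : CoprimeCoeffs G.laplacianPoly) {c : P.Piece → M} (hc : P.tangle.IsStrandColoring c)
    (htop : ∀ i, c (P.topPiece i) = 0) (hbot : ∀ i, c (P.bottomPiece i) = 0) (p : P.Piece) :
    c p = 0 := by
  obtain ⟨C, hC, hCc⟩ := P.exists_glue (c := Pi.single 0 c)
    -- Extension by zero outside `R`, consistent because the coloring vanishes on both boundary
    -- lines.
    (fun m => by
      rcases eq_or_ne m 0 with rfl | hm
      · rwa [Pi.single_eq_same]
      · rw [Pi.single_eq_of_ne hm]; exact .zero)
    (fun m i => by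
      have h : ∀ (m : ℤ) (q : P.Piece), c q = 0 →
          (Pi.single 0 c : ℤ → P.Piece → M) m q = 0 := fun m q hq => by
        rcases eq_or_ne m 0 with rfl | hm
        · rwa [Pi.single_eq_same]
        · rw [Pi.single_eq_of_ne hm]; rfl
      rw [h _ _ (htop i), h _ _ (hbot i)])
  have h0 : G.laplacianPoly ≠ 0 := fun h0 => by
    rw [h0] at hΔ
    exact absurd (hΔ 0 fun n => by simp) not_isUnit_zero
  have h1 := medial_coloring_eq_zero hG h0 hC (l := Filter.cofinite)
    (fun n => (add_left_injective n).tendsto_cofinite)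
    (fun d => by
      rw [Filter.eventually_cofinite]
      refine (Set.finite_singleton (-P.level ⟨d, 0⟩)).subset fun k hk => ?_
      rw [Set.mem_singleton_iff]
      by_contra hne
      refine hk ?_
      rw [hCc ⟨d, 0⟩ k, Pi.single_eq_of_ne (by intro h; exact hne (by linarith))]
      rfl)
    (fun a ha hfin => by
      obtain ⟨lo, hlo⟩ := hfin.bddBelow
      obtain ⟨hi, hhi⟩ := hfin.bddAbove
      refine LaurentPolynomial.eq_zero_of_coprimeCoeffs hΔ (lo := lo) (hi := hi + 1)
        (fun k hk => ?_) (fun k hk => ?_) ha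
      · by_contra h; exact absurd (hlo h) (by omega)
      · by_contra h; exact absurd (hhi h) (by omega))
    p.1 (-P.level p)
  rw [hCc, neg_add_cancel, Pi.single_eq_same] at h1
  exact h1

/-- If the Laplacian polynomial is monic, then a coloring of the half of `D` below a line that
vanishes along this line vanishes. -/
theorem eq_zero_of_monic [Fintype V] [Fintype E] (hG : G.IsPlane)
    (hΔ : MonicUpToSign G.laplacianPoly) {c : ℤ → P.Piece → M}
    (hc : ∀ m, P.tangle.IsStrandColoring (c m))
    (hmatch : ∀ m < 0, ∀ i, c m (P.topPiece i) = c (m + 1) (P.bottomPiece i))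
    (htop : ∀ i, c 0 (P.topPiece i) = 0) (p : P.Piece) : c 0 p = 0 := by
  obtain ⟨n, hn, hn'⟩ := hΔ
  -- The sequences vanish at high levels, so it is the trailing coefficient that must be a unit;
  -- symmetry turns the leading one into it.
  have hsymm : ∀ m, G.laplacianPoly.coeff m = G.laplacianPoly.coeff (-m) := fun m => by
    rw [← LaurentPolynomial.invert_apply, invert_laplacianPoly]
  obtain ⟨C, hC, hCc⟩ := P.exists_glue (c := fun m => if m ≤ 0 then c m else 0)
    (fun m => by
      split_ifs
      · exact hc m
      · exact .zero)
    (fun m i => by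
      rcases lt_trichotomy m 0 with h | rfl | h
      · rw [if_pos h.le, if_pos (by omega), hmatch m h]
      · simp [htop]
      · rw [if_neg (by omega), if_neg (by omega)]; rfl)
  have h0 : G.laplacianPoly ≠ 0 := fun h0 => by
    rw [h0] at hn
    exact not_isUnit_zero hn
  have h1 := medial_coloring_eq_zero hG h0 hC (l := Filter.atTop)
    (fun n => Filter.tendsto_atTop_add_const_right _ n Filter.tendsto_id)
    (fun d => by
      filter_upwards [Filter.eventually_gt_atTop (-P.level ⟨d, 0⟩)] with k hk
      rw [hCc ⟨d, 0⟩ k, if_neg (by omega)]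
      rfl)
    (fun a ha hev => by
      obtain ⟨hi, hhi⟩ := Filter.eventually_atTop.1 hev
      refine LaurentPolynomial.eq_zero_of_isUnit_trailing (n := -n) (by rwa [← hsymm])
        (fun m hm => ?_) hhi ha
      rw [hsymm]
      exact hn' _ (by omega))
    p.1 (-P.level p)
  rwa [hCc, neg_add_cancel, if_pos le_rfl] at h1

/-- If only finitely many colorings of `D_0` vanish on the top arcs, then the colors of the top arcs
can be prescribed. -/
theorem exists_coloring_of_finite [Fintype E]
    (hfin : {s : P.Piece → UnitAddCircle | P.tangle.IsStrandColoring s ∧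
      ∀ i, s (P.topPiece i) = 0}.Finite) (y : P.CutPoint → UnitAddCircle) :
    ∃ s, P.tangle.IsStrandColoring s ∧ ∀ i, s (P.topPiece i) = y i := by
  classical
  let δ : P.Piece → P.Piece → ℤ := fun p => Pi.single p 1
  let A : Matrix ((E ⊕ E) ⊕ P.CutPoint) P.Piece ℤ := Sum.elim
    (Sum.elim (fun e => δ (P.tangle.over₁ e) - δ (P.tangle.over₂ e))
      fun e => 2 • δ (P.tangle.over₁ e) - (δ (P.tangle.under₁ e) + δ (P.tangle.under₂ e)))
    fun i => δ (P.topPiece i)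
  have hδ : ∀ (x : P.Piece → UnitAddCircle) p, ∑ q, δ p q • x q = x p := fun x p => by
    simp [δ, Pi.single_apply, ite_smul]
  have hA : ∀ (x : P.Piece → UnitAddCircle) (y : P.CutPoint → UnitAddCircle),
      (∀ r, ∑ q, A r q • x q = Sum.elim (fun _ => 0) y r) ↔
      P.tangle.IsStrandColoring x ∧ ∀ i, x (P.topPiece i) = y i := by
    intro x y
    simp only [Sum.forall, A, Sum.elim_inl, Sum.elim_inr, Pi.sub_apply, sub_smul, Pi.smul_apply,
      smul_assoc, Finset.sum_sub_distrib, ← Finset.smul_sum, hδ, IsStrandColoring, forall_and,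
      Pi.add_apply, add_smul, Finset.sum_add_distrib, sub_eq_zero]
  obtain ⟨x, hx⟩ := UnitAddCircle.exists_solution A
    -- The system is square: two equations per crossing and one per cut point, against `count d + 1`
    -- pieces for each of the two darts of every edge.
    (by
      simp only [Fintype.card_sum, Fintype.card_sigma, Fintype.card_fin, Finset.sum_add_distrib,
        Finset.sum_const, Finset.card_univ, Fintype.card_prod, Fintype.card_bool, smul_eq_mul]
      ring)
    (hfin.subset fun x hx => (hA x 0).1 fun r => (hx r).trans (by rcases r with r | r <;> rfl))
    (Sum.elim (fun _ => 0) y)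
  exact ⟨x, (hA x y).1 hx⟩

end Position

end PeriodicGraph

/-- Let `G` be a plane `1`-periodic graph, `D` its medial link diagram and `D_0 = D ∩ R`.
(1) If the coefficients of `Δ_G` are coprime, then distinct `𝕋`-colorings of `D_0` that agree on the
top arcs differ on some bottom arc.
(2) If `Δ_G` is monic, then for the `𝕋`-colorings of `D_0` that are restrictions of `𝕋`-colorings
of `D`, the colors of the top arcs determine the colors of the bottom arcs; and this holds for all
`𝕋`-colorings of `D_0` if only finitely many of them vanish on the top arcs. -/
theorem mainTheorem12 {V E : Type*} [Fintype V] [Fintype E] (G : PeriodicGraph V E)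
    (hG : G.IsPlane) (P : G.Position) :
    (CoprimeCoeffs G.laplacianPoly →
      ∀ c₁ c₂ : P.tangle.Coloring, c₁ ≠ c₂ →
        (∀ i, c₁.1 (P.topArc i) = c₂.1 (P.topArc i)) →
        ∃ i, c₁.1 (P.bottomArc i) ≠ c₂.1 (P.bottomArc i)) ∧
    (MonicUpToSign G.laplacianPoly →
      (∀ C₁ C₂ : G.medial.Coloring,
        (∀ i, (P.restrict C₁).1 (P.topArc i) = (P.restrict C₂).1 (P.topArc i)) →
        ∀ i, (P.restrict C₁).1 (P.bottomArc i) = (P.restrict C₂).1 (P.bottomArc i)) ∧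
      (({c : P.tangle.Coloring | ∀ i, c.1 (P.topArc i) = 0}).Finite →
        ∀ c₁ c₂ : P.tangle.Coloring,
          (∀ i, c₁.1 (P.topArc i) = c₂.1 (P.topArc i)) →
          ∀ i, c₁.1 (P.bottomArc i) = c₂.1 (P.bottomArc i))) := by
  refine ⟨fun hΔ c₁ c₂ hne htop => ?_,
    fun hΔ => ⟨fun C₁ C₂ htop i => ?_, fun hfin c₁ c₂ htop i => ?_⟩⟩
  · by_contra! hbot
    refine hne (CrossingDiagram.Coloring.ext_strand fun p => ?_)
    exact sub_eq_zero.1 (P.eq_zero_of_coprimeCoeffs hG hΔ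
      (c₁.isStrandColoring.sub c₂.isStrandColoring) (fun i => sub_eq_zero.2 (htop i))
      (fun i => sub_eq_zero.2 (hbot i)) p)
  · have hC := C₁.isStrandColoring.sub C₂.isStrandColoring
    have h := P.eq_zero_of_monic hG hΔ (fun m => P.isStrandColoring_restrict hC m)
      -- Matching is automatic: the two pieces at a cut point belong to the same strand of `D`.
      (fun m _ i => by
        rw [P.bottomPiece_fst, P.level_bottomPiece, add_sub_add_right_eq_sub])
      (fun i => by
        rw [zero_sub]
        exact sub_eq_zero.2 (htop i)) (P.bottomPiece i)
    rw [zero_sub] at h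
    exact sub_eq_zero.1 h
  · have hfin' : {s : P.Piece → UnitAddCircle | P.tangle.IsStrandColoring s ∧
        ∀ i, s (P.topPiece i) = 0}.Finite :=
      (hfin.image fun c p => c.1 (P.tangle.arc p)).subset fun s hs =>
        ⟨.ofStrand hs.1, hs.2, rfl⟩
    choose f hf hftop using P.exists_coloring_of_finite hfin'
    -- `s n` colors the translate of `R` that lies `n` levels below; its top colors are prescribed
    -- by the bottom colors of the preceding one.
    let s : ℕ → P.Piece → UnitAddCircle := fun n => Nat.rec
      (fun p => c₁.1 (P.tangle.arc p) - c₂.1 (P.tangle.arc p))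
      (fun _ t => f fun i => t (P.bottomPiece i)) n
    have hs : ∀ n, P.tangle.IsStrandColoring (s n) := fun n => by
      cases n with
      | zero => exact c₁.isStrandColoring.sub c₂.isStrandColoring
      | succ n => exact hf _
    -- For `m > 0` the truncation gives `s 0`; this is harmless, since matching is only required
    -- below level `0`.
    have h := P.eq_zero_of_monic hG hΔ (c := fun m => s (-m).toNat) (fun m => hs _)
      (fun m hm i => by
        have h1 : (-m).toNat = (-(m + 1)).toNat + 1 := by omega
        rw [h1]
        exact hftop _ i)
      (fun i => sub_eq_zero.2 (htop i)) (P.bottomPiece i)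
    exact sub_eq_zero.1 h
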